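/- Consider the switched linear system $\dot x = A_\sigma x + B_\sigma u$, $y = C_\sigma x$ with $x(t)\in\mathbb R^{n}$, $u(t)\in\mathbb R^{m}$, $y(t)\in\mathbb R^{r}$, where $\sigma:[0,\infty)\to\mathcal P$ is right-continuous and piecewise constant (finitely many discontinuities in each bounded interval) and $\mathcal P$ is finite. Let $N_\sigma(t,s)$ be the number of discontinuities of $\sigma$ in $(s,t]$. Let $\tau_s>0$ be the sampling period and $N$ an odd positive integer. At each time $k\tau_s$, $k=0,1,2,\dots$, the output $y(k\tau_s)$ is encoded by a symbol $Q_k\in\{1,\dots,N^{r}\}$, and only $Q_k$ and $\sigma(k\tau_s)$ are transmitted to the controller. Assume that for every $p\in\mathcal P$: (1) $(A_p,B_p)$ is stabilizable, $(C_p,A_p)$ is observable, $K_p\in\mathbb R^{m\times n}$ is a given gain such that $A_p+B_pK_p$ is Hurwitz, and $\tau_s$ is not pathological for $A_p$, that is, no two eigenvalues of $A_p$ have equal real parts and imaginary parts that differ by a nonzero integer multiple of $2\pi/\tau_s$; (2) if $\eta_p$ is the smallest positive integer such that $W_p=\begin{bmatrix}C_p^\top & (C_pe^{A_p\tau_s})^\top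 & \cdots & (C_pe^{A_p(\eta_p-1)\tau_s})^\top\end{bmatrix}^\top$ has full column rank, and $W_p^\dagger$ is a given left inverse of $W_p$, then $$\|e^{A_p\eta_p\tau_s}W_p^\dagger\|_\infty\cdot\max_{0\le k\le\eta_p-1}\|C_pe^{A_pk\tau_s}\|_\infty<N ,$$ where $\|\cdot\|_\infty$ is the matrix norm induced by the maximum norms. Then there exist a number $\tau^*>0$ and an encoding and control strategy of the following form. The encoder determines $Q_k$ from $y(k\tau_s)$, $Q_0,\dots,Q_{k-1}$ and $\sigma(0),\dots,\sigma(k\tau_s)$; the decoder determines an estimate $\xi(k\tau_s)\in\mathbb R^n$ from $Q_0,\dots,Q_k$ and $\sigma(0),\dots,\sigma(k\tau_s)$; on $[k\tau_s,(k+1)\tau_s)$, with $p=\sigma(k\tau_s)$, one has $\dot\xi=(A_p+B_pK_p)\xi$ and $u=K_p\xi$. For all $\tau_a>\tau^*$ and $N_0\in\mathbb N$, this strategy achieves the following for the class of all switching signals $\sigma$ that satisfy $$N_\sigma(t,s)\le 1\ \text{ whenever } 0\le s<t,\ t-s\le\tau_s,\qquad N_\sigma(t,s)\le N_0+\frac{t-s}{\tau_a}\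 \text{ for all } t>s\ge 0 .$$ Convergence to the origin: for each such $\sigma$ (with any initial mode $\sigma(0)$) and each $x(0)\in\mathbb R^n$, the closed loop has a solution $x$ on $[0,\infty)$, and every such solution satisfies $\lim_{t\to\infty}x(t)=0$. Lyapunov stability: for every $\varepsilon>0$ there is $\delta>0$ (independent of $\sigma$) such that $|x(0)|<\delta$ implies $|x(t)|<\varepsilon$ for all $t\ge 0$, where $|\cdot|$ is the Euclidean norm. -/

import Mathlib

open Filter Topology Set

namespace SwitchedControl

noncomputable section

/-- The matrices of a switched linear system `ẋ = A_σ x + B_σ u`, `y = C_σ x` with state in `ℝⁿ`,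
input in `ℝᵐ`, output in `ℝʳ` and modes indexed by `Mode`. -/
structure SwitchedSystem (Mode : Type*) (n m r : ℕ) where
  A : Mode → Matrix (Fin n) (Fin n) ℝ
  B : Mode → Matrix (Fin n) (Fin m) ℝ
  C : Mode → Matrix (Fin r) (Fin n) ℝ

/-! ### Notions for a single linear system -/

/-- The set of complex eigenvalues of a real square matrix. -/
def eigenvalues {n : ℕ} (M : Matrix (Fin n) (Fin n) ℝ) : Set ℂ :=
  spectrum ℂ (M.map (algebraMap ℝ ℂ))

/-- `M` is Hurwitz: every complex eigenvalue has negative real part. -/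
def IsHurwitz {n : ℕ} (M : Matrix (Fin n) (Fin n) ℝ) : Prop :=
  ∀ z ∈ eigenvalues M, z.re < 0

/-- `(A, B)` is stabilizable: some state feedback makes `A + B K` Hurwitz. -/
def IsStabilizable {n m : ℕ} (A : Matrix (Fin n) (Fin n) ℝ) (B : Matrix (Fin n) (Fin m) ℝ) :
    Prop :=
  ∃ K : Matrix (Fin m) (Fin n) ℝ, IsHurwitz (A + B * K)

/-- `(C, A)` is observable: the stacked matrix of `C, C A, …, C A ^ (n - 1)` has trivial kernel. -/
def IsObservable {n r : ℕ} (C : Matrix (Fin r) (Fin n) ℝ) (A : Matrix (Fin n) (Fin n) ℝ) : Prop :=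
  ∀ v : Fin n → ℝ, (∀ k < n, (C * A ^ k).mulVec v = 0) → v = 0

/-- The sampling period `τ` is not pathological for `A`: no two eigenvalues of `A` have equal
real parts and imaginary parts that differ by a nonzero integer multiple of `2π / τ`. -/
def IsNonPathological {n : ℕ} (A : Matrix (Fin n) (Fin n) ℝ) (τ : ℝ) : Prop :=
  ∀ z ∈ eigenvalues A, ∀ w ∈ eigenvalues A, z.re = w.re →
    ∀ j : ℤ, j ≠ 0 → z.im - w.im ≠ j * (2 * Real.pi / τ)

/-- The matrix norm induced by the maximum norms (`α → ℝ` and `β → ℝ` carry the maximum norm). -/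
def infNorm {α β : Type*} [Fintype α] [Fintype β] (M : Matrix α β ℝ) : ℝ :=
  ‖LinearMap.toContinuousLinearMap M.mulVecLin‖

/-- The sampled observability matrix: `C, C e^{Aτ}, …, C e^{A(k-1)τ}` stacked. -/
def sampledObs {n r : ℕ} (C : Matrix (Fin r) (Fin n) ℝ) (A : Matrix (Fin n) (Fin n) ℝ) (τ : ℝ)
    (k : ℕ) : Matrix (Fin k × Fin r) (Fin n) ℝ :=
  Matrix.of fun i j => (C * NormedSpace.exp (((i.1 : ℝ) * τ) • A)) i.2 j

/-- The smallest positive natural number `k` such that the sampled observability matrix with `k`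
blocks has full column rank. -/
def obsIndex {n r : ℕ} (C : Matrix (Fin r) (Fin n) ℝ) (A : Matrix (Fin n) (Fin n) ℝ) (τ : ℝ) : ℕ :=
  sInf {k : ℕ | 1 ≤ k ∧ (sampledObs C A τ k).rank = n}

/-- The data-rate bound of one mode with `N` levels per output coordinate, for the left inverse `W'`
of the sampled observability matrix:
`‖e^{A η τ} W'‖_∞ · max_{0 ≤ k ≤ η - 1} ‖C e^{A k τ}‖_∞ < N`. -/
def DataRateBound {n r : ℕ} (C : Matrix (Fin r) (Fin n) ℝ) (A : Matrix (Fin n) (Fin n) ℝ) (τ : ℝ)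
    (W' : Matrix (Fin n) (Fin (obsIndex C A τ) × Fin r) ℝ) (N : ℕ) : Prop :=
  infNorm (NormedSpace.exp (((obsIndex C A τ : ℝ) * τ) • A) * W') *
    (⨆ k : Fin (obsIndex C A τ), infNorm (C * NormedSpace.exp (((k : ℝ) * τ) • A))) < N

/-! ### Switching signals (functions of time, of which only the values on `[0, ∞)` matter) -/

/-- The switching times: the discontinuities of `σ : [0, ∞) → Mode`, the set of modes being
discrete. (A right-continuous `σ` has no discontinuity at `0`.) -/
def switchingTimes {Mode : Type*} (σ : ℝ → Mode) : Set ℝ :=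
  {t | 0 < t ∧ ¬ ∀ᶠ s in 𝓝 t, σ s = σ t}

/-- `σ` is right-continuous and piecewise constant on `[0, ∞)`, with finitely many switching times
in each bounded interval. -/
structure IsSwitchingSignal {Mode : Type*} (σ : ℝ → Mode) : Prop where
  right_continuous : ∀ t, 0 ≤ t → ∀ᶠ s in 𝓝[>] t, σ s = σ t
  finite_switches : ∀ t, (switchingTimes σ ∩ Ioc 0 t).Finite

/-- `N_σ(t, s)`, the number of switching times in `(s, t]`. -/
def numSwitches {Mode : Type*} (σ : ℝ → Mode) (t s : ℝ) : ℕ :=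
  (switchingTimes σ ∩ Ioc s t).ncard

/-- Dwell time: at most one switch in every interval `(s, t]` of length at most `τ`. -/
def HasDwellTime {Mode : Type*} (σ : ℝ → Mode) (τ : ℝ) : Prop :=
  ∀ s t : ℝ, 0 ≤ s → s < t → t - s ≤ τ → numSwitches σ t s ≤ 1

/-- Average dwell time `τa` with chatter bound `N₀`. -/
def HasAverageDwellTime {Mode : Type*} (σ : ℝ → Mode) (τa : ℝ) (N₀ : ℕ) : Prop :=
  ∀ s t : ℝ, 0 ≤ s → s < t → (numSwitches σ t s : ℝ) ≤ N₀ + (t - s) / τa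

/-! ### Encoding and control -/

/-- An encoding and control strategy. At the `k`-th sampling time the encoder maps the measured
output to one of `N ^ r` symbols; besides the output it uses the symbols sent earlier and the
sampled modes up to now. The decoder computes a state estimate from the symbols and the sampled
modes received up to now. -/
structure Strategy (Mode : Type*) (n r N : ℕ) where
  encode : (k : ℕ) → (Fin r → ℝ) → (Fin k → Fin (N ^ r)) → (Fin (k + 1) → Mode) → Fin (N ^ r)
  decode : (k : ℕ) → (Fin (k + 1) → Fin (N ^ r)) → (Fin (k + 1) → Mode) → Fin n → ℝ

variable {Mode : Type*} {n m r N : ℕ}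

/-- The state estimate `ξ(t)`: with `k = ⌊t / τ⌋` and `p = σ(kτ)`, it starts at time `kτ` at the
value given by the decoder and satisfies `ξ' = (A_p + B_p K_p) ξ` until the next sampling time.
Here `q` is the sequence of transmitted symbols. -/
def estimate (sys : SwitchedSystem Mode n m r) (K : Mode → Matrix (Fin m) (Fin n) ℝ) (τ : ℝ)
    (S : Strategy Mode n r N) (σ : ℝ → Mode) (q : ℕ → Fin (N ^ r)) (t : ℝ) : Fin n → ℝ :=
  let k : ℕ := ⌊t / τ⌋₊
  let p : Mode := σ (k * τ)
  (NormedSpace.exp ((t - k * τ) • (sys.A p + sys.B p * K p))).mulVec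
    (S.decode k (fun i => q i) (fun i => σ (i * τ)))

/-- The control input `u(t) = K_p ξ(t)`, with `p` the mode at the last sampling time. -/
def control (sys : SwitchedSystem Mode n m r) (K : Mode → Matrix (Fin m) (Fin n) ℝ) (τ : ℝ)
    (S : Strategy Mode n r N) (σ : ℝ → Mode) (q : ℕ → Fin (N ^ r)) (t : ℝ) : Fin m → ℝ :=
  (K (σ (⌊t / τ⌋₊ * τ))).mulVec (estimate sys K τ S σ q t)

/-- `x : [0, ∞) → ℝⁿ` is a trajectory of the closed loop: `q` is the sequence of symbols that the
encoder produces from the sampled outputs `y(kτ)`, and `x` is continuous and solves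
`ẋ = A_σ x + B_σ u`. As `σ` and `u` are right-continuous with isolated discontinuities, the
equation is imposed through the right derivative at every time. -/
def IsTrajectory (sys : SwitchedSystem Mode n m r) (K : Mode → Matrix (Fin m) (Fin n) ℝ) (τ : ℝ)
    (S : Strategy Mode n r N) (σ : ℝ → Mode) (x : ℝ → Fin n → ℝ) : Prop :=
  ∃ q : ℕ → Fin (N ^ r),
    (∀ k : ℕ, q k = S.encode k ((sys.C (σ (k * τ))).mulVec (x (k * τ)))
      (fun i => q i) (fun i => σ (i * τ))) ∧
    ContinuousOn x (Ici 0) ∧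
    ∀ t : ℝ, 0 ≤ t →
      HasDerivWithinAt x
        ((sys.A (σ t)).mulVec (x t) + (sys.B (σ t)).mulVec (control sys K τ S σ q t)) (Ici t) t

/-- The Euclidean norm of a vector in `ℝⁿ`. -/
def euclNorm {n : ℕ} (v : Fin n → ℝ) : ℝ := ‖(WithLp.toLp 2 v : EuclideanSpace ℝ (Fin n))‖

end

end SwitchedControl

namespace SwitchedControl

noncomputable section

/-! In a sampling period with equal modes `p` at both ends the dwell time excludes any effective
switch. The error `x - ξ` then evolves by the open-loop map `e^{A_p τ}` and the estimate `ξ` by the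
Hurwitz closed-loop map. Let `E` bound the error at the start of a block of `η` samples. Each output
error of the block is at most `μ E`, with `μ` slightly above the maximum of `‖C e^{A k τ}‖`.
Quantization leaves `μ E / N`, and `e^{A η τ} W'` turns the recorded values into an estimate of the
error at the end of the block. By the data-rate bound its precision is at most `ϑ ^ η * E` with `ϑ <
1` (`Consistent.step_track`). After a mode change the estimate is reset to zero and `E` becomes a
multiple of `‖ξ‖ + E` that bounds the state.

Initially no bound on the state is known. The encoder searches with estimate zero and multiplies `E`
at each sample by a constant `c` larger than the growth factor `c₀` of the plant. Then `η`
consecutive outputs in the central cell in one mode capture the state (`Consistent.step_search`).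
Rare mode changes force capture in bounded time (`IsSampledTrajectory.captured_of_rate`). For `N =
1` symbols carry no information: the memory starts as captured with `E = 1`, which is right up to an
unknown scale `s`.

The function `V = g(ξ) + κ E ϑ ^ pos` shrinks by `lam < 1` in each captured period without mode
change (`Consistent.lyapunov_step_le`) and grows at most by `H` in any other. Under a large average
dwell time it decays geometrically, and it dominates the state after capture.

As `E` starts at `1`, this decay bound does not become small with `x(0)`. Stability needs a second
argument: for small `x(0)` all symbols are zero during `T` periods
(`IsSampledTrajectory.est_eq_zero_of_small`), so the state is at most `c₀ ^ T * ‖x(0)‖`, and after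
`T` the decay bound, uniform in such `x(0)`, is below `ε`. -/

/-! ### Uniform quantizer -/

/-- The center of the cell with index `i` when `[-1, 1]` is divided into `N` equal cells. -/
def cellCenter (N : ℕ) (i : Fin N) : ℝ := (2 * (i : ℝ) + 1 - N) / N

theorem abs_cellCenter_le_one {N : ℕ} (i : Fin N) : |cellCenter N i| ≤ 1 := by
  have hi : ((i : ℕ) : ℝ) + 1 ≤ N := by exact_mod_cast i.2
  have h0 : (0 : ℝ) ≤ (i : ℕ) := Nat.cast_nonneg _
  have hN : (0 : ℝ) < N := by linarith
  rw [cellCenter, abs_div, abs_of_pos hN, div_le_one hN, abs_le]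
  constructor <;> linarith

theorem cellCenter_one (i : Fin 1) : cellCenter 1 i = 0 := by
  simp [cellCenter]

/-- The scalar uniform quantizer: it has accuracy `1 / N` on `[-1, 1]`, its zero value is taken on
the open central cell, and only there up to the boundary unless there is a single cell. -/
theorem exists_cell {N : ℕ} (hN : Odd N) (y : ℝ) :
    ∃ i : Fin N, (|y| ≤ 1 → |y - cellCenter N i| ≤ 1 / N) ∧
      (|y| ≤ 1 / N → cellCenter N i = 0) ∧
      (N ≠ 1 → cellCenter N i = 0 → |y| ≤ 1 / N) := by
  obtain ⟨M, rfl⟩ := hN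
  have hpos : (0 : ℝ) < ((2 * M + 1 : ℕ) : ℝ) := by positivity
  by_cases hy : |y| ≤ 1 / ((2 * M + 1 : ℕ) : ℝ)
  · have h0 : cellCenter (2 * M + 1) ⟨M, by omega⟩ = 0 := by
      simp [cellCenter]
    exact ⟨⟨M, by omega⟩, fun _ => by rwa [h0, sub_zero], fun _ => h0, fun _ _ => hy⟩
  rcases Nat.eq_zero_or_pos M with rfl | hM
  · refine ⟨⟨0, by omega⟩, fun h => absurd (by simpa using h) hy, fun h => absurd h hy,
      fun h => absurd rfl h⟩
  have key : ∃ i : ℕ, i < 2 * M + 1 ∧ i ≠ M ∧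
      (|y| ≤ 1 → |y * ((2 * M + 1 : ℕ) : ℝ) - (2 * (i : ℝ) - 2 * M)| ≤ 1) := by
    by_cases hy1 : |y| ≤ 1
    · set z := y * ((2 * M + 1 : ℕ) : ℝ) with hz
      have hzN : |z| ≤ 2 * M + 1 := by
        rw [hz, abs_mul, abs_of_pos hpos]
        push_cast
        push_cast at hpos
        nlinarith
      have hz1 : 1 < |z| := by
        rw [not_le, div_lt_iff₀ hpos] at hy
        rwa [hz, abs_mul, abs_of_pos hpos]
      rcases lt_or_ge 0 z with hz0 | hz0
      · rw [abs_of_pos hz0] at hzN hz1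
        -- In the scale of `z` cell `i` has center `2 (i - M)` and half-width `1`. The ceiling is
        -- the least offset whose upper edge reaches `z`, and it is nonzero as `z > 1`.
        have h1 := Nat.ceil_lt_add_one (show 0 ≤ (z - 1) / 2 by linarith)
        have h2 := Nat.le_ceil ((z - 1) / 2)
        have h3 : 0 < ⌈(z - 1) / 2⌉₊ := Nat.ceil_pos.2 (by linarith)
        have h4 : ⌈(z - 1) / 2⌉₊ ≤ M := Nat.ceil_le.2 (by linarith)
        refine ⟨M + ⌈(z - 1) / 2⌉₊, by omega, by omega, fun _ => ?_⟩
        push_cast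
        rw [abs_le]
        constructor <;> linarith
      · rw [abs_of_nonpos hz0] at hzN hz1
        have h1 := Nat.ceil_lt_add_one (show 0 ≤ (-z - 1) / 2 by linarith)
        have h2 := Nat.le_ceil ((-z - 1) / 2)
        have h3 : 0 < ⌈(-z - 1) / 2⌉₊ := Nat.ceil_pos.2 (by linarith)
        have h4 : ⌈(-z - 1) / 2⌉₊ ≤ M := Nat.ceil_le.2 (by linarith)
        refine ⟨M - ⌈(-z - 1) / 2⌉₊, by omega, by omega, fun _ => ?_⟩
        rw [Nat.cast_sub h4, abs_le]
        constructor <;> linarith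
    · exact ⟨0, by omega, by omega, fun h => absurd h hy1⟩
  obtain ⟨i, hi, hiM, hacc⟩ := key
  refine ⟨⟨i, hi⟩, fun h => ?_, fun h => absurd h hy, fun _ h0 => ?_⟩
  · have h2 : y - cellCenter (2 * M + 1) ⟨i, hi⟩ =
        (y * ((2 * M + 1 : ℕ) : ℝ) - (2 * (i : ℝ) - 2 * M)) / ((2 * M + 1 : ℕ) : ℝ) := by
      rw [cellCenter, eq_div_iff hpos.ne', sub_mul, div_mul_cancel₀ _ hpos.ne']
      push_cast
      ring
    rw [h2, abs_div, abs_of_pos hpos]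
    exact div_le_div_of_nonneg_right (hacc h) hpos.le
  · exfalso
    apply hiM
    rw [cellCenter, div_eq_zero_iff, or_iff_left hpos.ne'] at h0
    push_cast at h0
    have : (i : ℝ) = M := by linarith
    exact_mod_cast this

/-- The value in `[-1, 1]ʳ` that a symbol stands for. -/
def symbolValue (N r : ℕ) (q : Fin (N ^ r)) : Fin r → ℝ :=
  fun j => cellCenter N (finFunctionFinEquiv.symm q j)

theorem norm_symbolValue_le_one {N r : ℕ} (q : Fin (N ^ r)) : ‖symbolValue N r q‖ ≤ 1 :=
  (pi_norm_le_iff_of_nonneg zero_le_one).2 fun _ => abs_cellCenter_le_one _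

theorem symbolValue_one {r : ℕ} (q : Fin (1 ^ r)) : symbolValue 1 r q = 0 :=
  funext fun _ => cellCenter_one _

/-- The uniform quantizer with `N` levels per coordinate on the cube of radius `R`. -/
theorem exists_symbol {N : ℕ} (hN : Odd N) {r : ℕ} (R : ℝ) (y : Fin r → ℝ) :
    ∃ q : Fin (N ^ r), 0 < R →
      ((‖y‖ ≤ R → ‖y - R • symbolValue N r q‖ ≤ R / N) ∧
      (‖y‖ ≤ R / N → symbolValue N r q = 0) ∧
      (N ≠ 1 → symbolValue N r q = 0 → ‖y‖ ≤ R / N)) := by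
  choose i h1 h2 h3 using fun j => exists_cell hN (y j / R)
  refine ⟨finFunctionFinEquiv i, fun hR => ?_⟩
  have hv : ∀ j, symbolValue N r (finFunctionFinEquiv i) j = cellCenter N (i j) := fun j => by
    simp [symbolValue]
  have hRN : 0 ≤ R / N := by positivity
  have hdiv : ∀ j b, |y j / R| ≤ b ↔ |y j| ≤ R * b := fun j b => by
    rw [abs_div, abs_of_pos hR, div_le_iff₀ hR, mul_comm]
  refine ⟨fun h => ?_, fun h => ?_, fun hN1 h => ?_⟩
  · rw [pi_norm_le_iff_of_nonneg hRN]
    intro j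
    have := h1 j ((hdiv j 1).2 (by simpa using (norm_le_pi_norm y j).trans h))
    rw [Pi.sub_apply, Pi.smul_apply, hv, smul_eq_mul, Real.norm_eq_abs]
    have e : y j - R * cellCenter N (i j) = R * (y j / R - cellCenter N (i j)) := by
      field_simp
    rw [e, abs_mul, abs_of_pos hR, div_eq_mul_one_div R]
    exact mul_le_mul_of_nonneg_left this hR.le
  · funext j
    rw [hv, Pi.zero_apply]
    refine h2 j ((hdiv j _).2 ?_)
    rw [← div_eq_mul_one_div]
    exact (norm_le_pi_norm y j).trans h
  · rw [pi_norm_le_iff_of_nonneg hRN]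
    intro j
    have := h3 j hN1 (by rw [← hv, h, Pi.zero_apply])
    rw [hdiv, ← div_eq_mul_one_div] at this
    exact this

/-- The symbol of the uniform quantizer with `N` levels per coordinate on the cube of radius `R`. -/
def quantize {N : ℕ} (hN : Odd N) {r : ℕ} (R : ℝ) (y : Fin r → ℝ) : Fin (N ^ r) :=
  (exists_symbol hN R y).choose

/-- The quantization error inside the range; a single level has this accuracy at every scale. -/
theorem norm_sub_quantize_le {N : ℕ} (hN : Odd N) {r : ℕ} {R : ℝ} (hR : 0 < R) {y : Fin r → ℝ}
    {s : ℝ} (hs : N = 1 ∨ s = 1) (hy : ‖y‖ ≤ s * R) :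
    ‖y - R • symbolValue N r (quantize hN R y)‖ ≤ s * R / N := by
  rcases hs with rfl | rfl
  · simpa [symbolValue_one] using hy
  · rw [one_mul] at *
    exact ((exists_symbol hN R y).choose_spec hR).1 hy

theorem quantize_eq_zero {N : ℕ} (hN : Odd N) {r : ℕ} {R : ℝ} (hR : 0 < R) {y : Fin r → ℝ}
    (hy : ‖y‖ ≤ R / N) : symbolValue N r (quantize hN R y) = 0 :=
  ((exists_symbol hN R y).choose_spec hR).2.1 hy

theorem norm_le_of_quantize_eq_zero {N : ℕ} (hN : Odd N) {r : ℕ} {R : ℝ} (hR : 0 < R)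
    {y : Fin r → ℝ} (hN1 : N ≠ 1) (h : symbolValue N r (quantize hN R y) = 0) : ‖y‖ ≤ R / N :=
  ((exists_symbol hN R y).choose_spec hR).2.2 hN1 h

/-! ### Exponentials of Hurwitz matrices -/

attribute [local instance] Matrix.linftyOpNormedAddCommGroup Matrix.linftyOpNormedRing
  Matrix.linftyOpNormedSpace Matrix.linftyOpNormedAlgebra

theorem exp_mulVec_of_mulVec_eq_smul {n : ℕ} (M : Matrix (Fin n) (Fin n) ℂ) {v : Fin n → ℂ} {w : ℂ}
    (h : M.mulVec v = w • v) : (NormedSpace.exp M).mulVec v = Complex.exp w • v := by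
  have hpow : ∀ k : ℕ, (M ^ k).mulVec v = w ^ k • v := by
    intro k
    induction k with
    | zero => simp
    | succ k ih => rw [pow_succ', ← Matrix.mulVec_mulVec, ih, Matrix.mulVec_smul, h, smul_smul,
        pow_succ]
  let L : Matrix (Fin n) (Fin n) ℂ →L[ℂ] (Fin n → ℂ) :=
    LinearMap.toContinuousLinearMap ((Matrix.mulVecBilin ℂ ℂ).flip v)
  have hL : ∀ X, L X = X.mulVec v := fun _ => rfl
  have h1 := (NormedSpace.exp_series_hasSum_exp' (𝕂 := ℂ) M).mapL L
  have h2 := (NormedSpace.exp_series_hasSum_exp' (𝕂 := ℂ) w).smul_const v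
  rw [hL] at h1
  rw [Complex.exp_eq_exp_ℂ]
  refine h1.unique ?_
  convert! h2 using 2 with k
  rw [map_smul, hL, hpow, smul_assoc]

/-- An eigenspace of `exp M` is invariant under `M`, which commutes with `exp M`, so it contains an
eigenvector of `M`, common to both matrices. -/
theorem exists_mem_spectrum_of_mem_spectrum_exp {n : ℕ} (M : Matrix (Fin n) (Fin n) ℂ) {z : ℂ}
    (hz : z ∈ spectrum ℂ (NormedSpace.exp M)) : ∃ w ∈ spectrum ℂ M, z = Complex.exp w := by
  rw [← Matrix.spectrum_toLin', ← Module.End.hasEigenvalue_iff_mem_spectrum] at hz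
  set T : Module.End ℂ (Fin n → ℂ) := Matrix.toLin' (NormedSpace.exp M) with hT
  set S : Module.End ℂ (Fin n → ℂ) := Matrix.toLin' M with hS
  have hcomm : Commute T S := by
    have : Commute (NormedSpace.exp M) M := (Commute.refl M).exp_left
    exact this.map (Matrix.toLinAlgEquiv' (R := ℂ) (n := Fin n))
  have hmap : MapsTo S (Module.End.eigenspace T z) (Module.End.eigenspace T z) :=
    Module.End.mapsTo_genEigenspace_of_comm hcomm z 1
  have : Nontrivial (Module.End.eigenspace T z) := (Submodule.nontrivial_iff_ne_bot).2 hz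
  obtain ⟨w, hw⟩ := Module.End.exists_eigenvalue (S.restrict hmap)
  obtain ⟨v, hv⟩ := hw.exists_hasEigenvector
  have hv0 : (v : Fin n → ℂ) ≠ 0 := fun h => hv.2 (Subtype.ext h)
  have hSv : M.mulVec (v : Fin n → ℂ) = w • (v : Fin n → ℂ) := by
    have := congrArg Subtype.val hv.apply_eq_smul
    simpa [hS] using this
  have hTv : (NormedSpace.exp M).mulVec (v : Fin n → ℂ) = z • (v : Fin n → ℂ) := by
    have := Module.End.mem_eigenspace_iff.1 v.2
    simpa [hT] using this
  refine ⟨w, ?_, ?_⟩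
  · rw [← Matrix.spectrum_toLin', ← Module.End.hasEigenvalue_iff_mem_spectrum]
    exact Module.End.hasEigenvalue_of_hasEigenvector (x := (v : Fin n → ℂ))
      ⟨Module.End.mem_eigenspace_iff.2 (by simpa using hSv), hv0⟩
  · rw [exp_mulVec_of_mulVec_eq_smul M hSv] at hTv
    exact (smul_left_injective ℂ hv0 hTv).symm

/-- The eigenvalues of `exp (τ F)` lie in the open unit disc, and Gelfand's formula turns this into
a bound on some power. Complexification preserves the norm used. -/
theorem IsHurwitz.exists_norm_pow_le {n : ℕ} {F : Matrix (Fin n) (Fin n) ℝ} (hF : IsHurwitz F)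
    {τ : ℝ} (hτ : 0 < τ) :
    ∃ (j : ℕ) (ρ : ℝ), 0 < j ∧ 0 < ρ ∧ ρ < 1 ∧ ‖(NormedSpace.exp (τ • F)) ^ j‖ ≤ ρ ^ j := by
  set φ : Matrix (Fin n) (Fin n) ℝ →+* Matrix (Fin n) (Fin n) ℂ := (algebraMap ℝ ℂ).mapMatrix
  have hφ : Continuous φ :=
    continuous_id.matrix_map Complex.continuous_ofReal
  have hφn : ∀ X, ‖φ X‖ = ‖X‖ := fun X => by
    simp [φ, Matrix.linfty_opNorm_def, Complex.nnnorm_real]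
  set Mc := NormedSpace.exp (φ (τ • F)) with hMc
  have hexp : φ (NormedSpace.exp (τ • F)) = Mc := NormedSpace.map_exp φ hφ _
  rcases Nat.eq_zero_or_pos n with rfl | hn
  · refine ⟨1, 1 / 2, one_pos, by norm_num, by norm_num, ?_⟩
    rw [Subsingleton.elim (NormedSpace.exp (τ • F) ^ 1) 0, norm_zero]
    norm_num
  have : Nonempty (Fin n) := ⟨⟨0, hn⟩⟩
  have hlt : ∀ z ∈ spectrum ℂ Mc, ‖z‖₊ < 1 := by
    intro z hz
    obtain ⟨w, hw, rfl⟩ := exists_mem_spectrum_of_mem_spectrum_exp _ hz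
    have hs : φ (τ • F) = (τ : ℂ) • φ F := by
      ext i j
      simp [φ]
    have hw' : w / τ ∈ eigenvalues F := by
      have hu : (τ : ℂ) ≠ 0 := by exact_mod_cast hτ.ne'
      have := (spectrum.smul_mem_smul_iff (r := Units.mk0 (τ : ℂ) hu) (s := w / τ) (a := φ F)).1
      simp only [Units.smul_def, Units.val_mk0, smul_eq_mul, mul_div_cancel₀ w hu] at this
      rw [← hs] at this
      exact this hw
    have := hF _ hw'
    rw [← NNReal.coe_lt_coe, coe_nnnorm, Complex.norm_exp, NNReal.coe_one, Real.exp_lt_one_iff]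
    rw [Complex.div_ofReal_re] at this
    by_contra hcon
    exact absurd (div_nonneg (not_lt.1 hcon) hτ.le) (not_le.2 this)
  have hrad := spectrum.spectralRadius_lt_of_forall_lt Mc hlt
  obtain ⟨ρ, hρ1, hρ2⟩ := ENNReal.lt_iff_exists_nnreal_btwn.1 hrad
  have hev := (spectrum.pow_nnnorm_pow_one_div_tendsto_nhds_spectralRadius Mc).eventually
    (gt_mem_nhds hρ1)
  obtain ⟨j, hj, hj0⟩ := (hev.and (eventually_gt_atTop 0)).exists
  have hρ0 : 0 < ρ := by
    have := (zero_le (a := spectralRadius ℂ Mc)).trans_lt hρ1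
    exact_mod_cast this
  refine ⟨j, ρ, hj0, by exact_mod_cast hρ0, by exact_mod_cast hρ2, ?_⟩
  rw [← hφn, map_pow, hexp]
  have := ENNReal.rpow_le_rpow hj.le (Nat.cast_nonneg (α := ℝ) j)
  rw [← ENNReal.rpow_mul, one_div, inv_mul_cancel₀ (by positivity), ENNReal.rpow_one,
    ENNReal.rpow_natCast] at this
  exact_mod_cast this

/-- A norm-like function that is contracted by a linear map some power of which is a
contraction. -/
theorem exists_contracted_gauge {E : Type*} [NormedAddCommGroup E] [NormedSpace ℝ E]
    (Φ : E →L[ℝ] E) {j : ℕ} {ρ : ℝ} (hj : 0 < j) (hρ : 0 < ρ) (h : ‖Φ ^ j‖ ≤ ρ ^ j) :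
    ∃ (g : E → ℝ) (L : ℝ), 0 < L ∧ g 0 = 0 ∧ (∀ v, ‖v‖ ≤ g v) ∧ (∀ v, g v ≤ L * ‖v‖) ∧
      (∀ v w, g (v + w) ≤ g v + g w) ∧ ∀ v, g (Φ v) ≤ ρ * g v := by
  have hterm : ∀ v (i : ℕ), 0 ≤ (ρ⁻¹) ^ i * ‖(Φ ^ i) v‖ := fun v i => by positivity
  -- Applying `Φ` shifts the orbit sum by one place; the term gained, `ρ⁻ʲ ‖Φʲ v‖`, is at most the
  -- term lost, `‖v‖`. The `+ 1` only makes `L` positive.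
  refine ⟨fun v => ∑ i ∈ Finset.range j, (ρ⁻¹) ^ i * ‖(Φ ^ i) v‖,
    ∑ i ∈ Finset.range j, (ρ⁻¹) ^ i * (‖Φ ^ i‖ + 1), ?_, by simp, fun v => ?_, fun v => ?_,
    fun v w => ?_, fun v => ?_⟩
  · exact Finset.sum_pos (fun i _ => by positivity) ⟨0, Finset.mem_range.2 hj⟩
  · have := Finset.single_le_sum (fun i _ => hterm v i) (Finset.mem_range.2 hj)
    simpa using this
  · rw [Finset.sum_mul]
    refine Finset.sum_le_sum fun i _ => ?_
    rw [mul_assoc]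
    refine mul_le_mul_of_nonneg_left ?_ (by positivity)
    exact ((Φ ^ i).le_opNorm v).trans (by gcongr; linarith)
  · rw [← Finset.sum_add_distrib]
    refine Finset.sum_le_sum fun i _ => ?_
    rw [← mul_add, map_add]
    exact mul_le_mul_of_nonneg_left (norm_add_le _ _) (by positivity)
  · have e : ∀ i : ℕ, (ρ⁻¹) ^ i * ‖(Φ ^ i) (Φ v)‖ = ρ * ((ρ⁻¹) ^ (i + 1) * ‖(Φ ^ (i + 1)) v‖) := by
      intro i
      rw [pow_succ Φ, mul_apply_eq_comp, pow_succ]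
      field_simp
    simp only [e]
    rw [← Finset.mul_sum]
    refine mul_le_mul_of_nonneg_left ?_ hρ.le
    have h1 := Finset.sum_range_succ (fun i => (ρ⁻¹) ^ i * ‖(Φ ^ i) v‖) j
    have h2 := Finset.sum_range_succ' (fun i => (ρ⁻¹) ^ i * ‖(Φ ^ i) v‖) j
    have h3 : (ρ⁻¹) ^ j * ‖(Φ ^ j) v‖ ≤ ‖v‖ := by
      calc (ρ⁻¹) ^ j * ‖(Φ ^ j) v‖ ≤ (ρ⁻¹) ^ j * (ρ ^ j * ‖v‖) := by
            gcongr
            exact (Φ ^ j).le_of_opNorm_le h v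
        _ = ‖v‖ := by rw [← mul_assoc, ← mul_pow, inv_mul_cancel₀ hρ.ne', one_pow, one_mul]
    simp only [pow_zero, one_mul, one_apply_eq_self] at h2
    linarith

/-! ### The controller as a state machine -/

/-- The sampled dynamics of one mode, with the constants of its encoder: `Ψ` is the open-loop and
`Φ` the closed-loop transition map over one sampling period, `G` recovers the state from `η`
successive outputs and propagates it to the end of the block, and `g` is a gauge contracted by
`Φ`. -/
structure ModeData (n r N : ℕ) where
  η : ℕ
  C : (Fin n → ℝ) →L[ℝ] (Fin r → ℝ)
  Φ : (Fin n → ℝ) →L[ℝ] (Fin n → ℝ)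
  Ψ : (Fin n → ℝ) →L[ℝ] (Fin n → ℝ)
  G : (Fin η × Fin r → ℝ) →L[ℝ] (Fin n → ℝ)
  g : (Fin n → ℝ) → ℝ
  μ : ℝ
  ϑ : ℝ
  κ : ℝ
  lam : ℝ
  η_pos : 0 < η
  G_outputs : ∀ z, G (fun i => C ((Ψ ^ (i.1 : ℕ)) z) i.2) = (Ψ ^ η) z
  μ_pos : 0 < μ
  norm_output_le : ∀ i < η, ∀ z, ‖C ((Ψ ^ i) z)‖ ≤ μ * ‖z‖
  ϑ_pos : 0 < ϑ
  norm_G_mul_le : ‖G‖ * μ ≤ N * ϑ ^ η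
  g_zero : g 0 = 0
  norm_le_g : ∀ v, ‖v‖ ≤ g v
  g_add_le : ∀ v w, g (v + w) ≤ g v + g w
  g_Φ_le : ∀ v, g (Φ v) ≤ lam * g v
  ϑ_le_lam : ϑ ≤ lam
  lam_lt_one : lam < 1
  one_le_κ_mul : 1 ≤ κ * ϑ ^ η
  -- The balance at the end of a block: the correction `G v` of the estimate and the contracted
  -- bound against the bound term at position `η - 1`.
  g_G_le : ∀ v E, 0 ≤ E → ‖v‖ ≤ μ * E →
    g (G v) + κ * (ϑ ^ η * E) ≤ lam * (κ * E * ϑ ^ (η - 1))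

/-- The modes of a switched system with constants that bound them uniformly. -/
structure Design (Mode : Type*) (n r N : ℕ) where
  mode : Mode → ModeData n r N
  c₀ : ℝ
  b : ℝ
  c : ℝ
  a : ℝ
  lam : ℝ
  H : ℝ
  η : ℕ
  one_le_c₀ : 1 ≤ c₀
  b_nonneg : 0 ≤ b
  norm_C_le : ∀ p, ‖(mode p).C‖ ≤ b
  norm_Ψ_pow_le : ∀ p, ∀ i < (mode p).η, ‖(mode p).Ψ ^ i‖ ≤ b
  norm_G_le : ∀ p, ‖(mode p).G‖ ≤ c
  le_c : c₀ * (2 + b) ≤ c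
  a_pos : 0 < a
  a_le_one : a ≤ 1
  a_le_ϑ : ∀ p, a ≤ (mode p).ϑ ^ (mode p).η
  a_le_μ : ∀ p, a * N ≤ (mode p).μ
  lam_pos : 0 < lam
  lam_lt_one : lam < 1
  le_lam : ∀ p, (mode p).lam ≤ lam
  one_le_H : 1 ≤ H
  le_H : ∀ p, 2 * c * (mode p).κ ≤ H
  le_η : ∀ p, (mode p).η ≤ η

/-- The memory of the encoder and of the decoder: whether a bound on the state is known, the
position in the current block of samples, the state estimate, the recorded outputs of the block
and the bound. -/
structure Memory (n r : ℕ) where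
  captured : Bool
  pos : ℕ
  est : Fin n → ℝ
  outputs : ℕ → Fin r → ℝ
  -- After capture this refers to the error at the start of the current block; during the search it
  -- is the threshold for the outputs.
  bound : ℝ

variable {Mode : Type*} {n m r N : ℕ}

/-- The radius of the quantizer. -/
def radius (D : Design Mode n r N) (p : Mode) (Z : Memory n r) : ℝ :=
  -- During the search the factor `N` makes the central cell the cube of radius `Z.bound`.
  if Z.captured then (D.mode p).μ * Z.bound else N * Z.bound

open Classical in
/-- The transition of the memory between two sampling times with modes `p` and `p'`, where `u` is
the value in `[-1, 1]ʳ` of the symbol sent at the first of them. -/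
def step (D : Design Mode n r N) (p p' : Mode) (u : Fin r → ℝ) (Z : Memory n r) : Memory n r :=
  if p' = p then
    if Z.captured then
      if Z.pos + 1 = (D.mode p).η then
        ⟨true, 0, (D.mode p).Φ Z.est + (D.mode p).G
          (fun i => Function.update Z.outputs Z.pos (((D.mode p).μ * Z.bound) • u) i.1 i.2), 0,
          (D.mode p).ϑ ^ (D.mode p).η * Z.bound⟩
      else ⟨true, Z.pos + 1, (D.mode p).Φ Z.est,
        Function.update Z.outputs Z.pos (((D.mode p).μ * Z.bound) • u), Z.bound⟩
    -- A run of `η` zero symbols captures the state; any other symbol restarts the count.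
    else if u = 0 then
      if Z.pos + 1 = (D.mode p).η then ⟨true, 0, 0, 0, D.c * Z.bound⟩
      else ⟨false, Z.pos + 1, 0, 0, D.c * Z.bound⟩
    else ⟨false, 0, 0, 0, D.c * Z.bound⟩
  else ⟨Z.captured, 0, 0, 0, D.c * (‖Z.est‖ + Z.bound)⟩

/-- The memory at the `k`-th sampling time. -/
def memory (D : Design Mode n r N) (p : ℕ → Mode) (q : ℕ → Fin (N ^ r)) : ℕ → Memory n r
  | 0 => ⟨decide (N = 1), 0, 0, 0, 1⟩
  | k + 1 => step D (p k) (p (k + 1)) (symbolValue N r (q k)) (memory D p q k)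

theorem memory_congr (D : Design Mode n r N) {p p' : ℕ → Mode} {q q' : ℕ → Fin (N ^ r)} {k : ℕ}
    (hp : ∀ i ≤ k, p i = p' i) (hq : ∀ i < k, q i = q' i) : memory D p q k = memory D p' q' k := by
  induction k with
  | zero => rfl
  | succ k ih =>
    rw [memory, memory, ih (fun i hi => hp i (by omega)) (fun i hi => hq i (by omega)),
      hp k (by omega), hp (k + 1) le_rfl, hq k (by omega)]

/-- What the memory `Z` tells about the state `X` of the plant in mode `p`, up to the scale `s`. -/
structure Consistent (D : Design Mode n r N) (s : ℝ) (p : Mode) (X : Fin n → ℝ)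
    (Z : Memory n r) : Prop where
  pos_lt : Z.pos < (D.mode p).η
  bound_pos : 0 < Z.bound
  of_one : N = 1 → Z.captured = true
  est_eq_zero : Z.captured = false → Z.est = 0
  -- Here `z` is the state at the start of the current run of zero symbols; in `track` it is the
  -- error at the start of the block.
  search : Z.captured = false → ∃ z, X = ((D.mode p).Ψ ^ Z.pos) z ∧
    ∀ i < Z.pos, ‖(D.mode p).C (((D.mode p).Ψ ^ i) z)‖ ≤ Z.bound
  norm_outputs_le : Z.captured = true → ∀ i < Z.pos, ‖Z.outputs i‖ ≤ (D.mode p).μ * Z.bound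
  track : Z.captured = true → ∃ z, ‖z‖ ≤ s * Z.bound ∧ X - Z.est = ((D.mode p).Ψ ^ Z.pos) z ∧
    ∀ i < Z.pos, ‖(D.mode p).C (((D.mode p).Ψ ^ i) z) - Z.outputs i‖ ≤
      s * ((D.mode p).μ * Z.bound) / N

/-! ### Preservation of consistency -/

namespace Design

variable (D : Design Mode n r N)

theorem c₀_pos : 0 < D.c₀ := one_pos.trans_le D.one_le_c₀

theorem two_mul_c₀_le : 2 * D.c₀ ≤ D.c := by
  have := D.le_c
  have := mul_nonneg D.c₀_pos.le D.b_nonneg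
  linarith

theorem one_le_c : 1 ≤ D.c := by
  have := D.two_mul_c₀_le
  have := D.one_le_c₀
  linarith

theorem c_pos : 0 < D.c := one_pos.trans_le D.one_le_c

end Design

theorem radius_pos (hN : Odd N) {D : Design Mode n r N} {s : ℝ} {p : Mode} {X : Fin n → ℝ}
    {Z : Memory n r} (h : Consistent D s p X Z) : 0 < radius D p Z := by
  have hN' : (0 : ℝ) < N := by exact_mod_cast hN.pos
  rw [radius]
  split_ifs
  · exact mul_pos (D.mode p).μ_pos h.bound_pos
  · exact mul_pos hN' h.bound_pos

theorem Consistent.norm_sub_est_le {D : Design Mode n r N} {s : ℝ} {p : Mode} {X : Fin n → ℝ}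
    {Z : Memory n r} (h : Consistent D s p X Z) (hc : Z.captured = true) :
    ‖X - Z.est‖ ≤ D.b * (s * Z.bound) := by
  obtain ⟨z, hz, hX, -⟩ := h.track hc
  rw [hX]
  exact (((D.mode p).Ψ ^ Z.pos).le_of_opNorm_le (D.norm_Ψ_pow_le p _ h.pos_lt) z).trans
    (mul_le_mul_of_nonneg_left hz D.b_nonneg)

/-- The memory stays consistent with the plant after a switch. -/
theorem Consistent.step_of_ne {D : Design Mode n r N} {s : ℝ} (hs : 1 ≤ s) {p p' : Mode}
    {X X' : Fin n → ℝ} {Z : Memory n r} (h : Consistent D s p X Z) (hp : p' ≠ p)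
    (u : Fin r → ℝ) (hX' : ‖X'‖ ≤ D.c₀ * (‖X‖ + ‖Z.est‖)) :
    Consistent D s p' X' (step D p p' u Z) := by
  have hE := h.bound_pos
  have hst : step D p p' u Z = ⟨Z.captured, 0, 0, 0, D.c * (‖Z.est‖ + Z.bound)⟩ := by
    rw [step, if_neg hp]
  rw [hst]
  refine ⟨(D.mode p').η_pos, mul_pos D.c_pos (by positivity), h.of_one, fun _ => rfl,
    fun _ => ⟨X', by simp, fun i hi => absurd hi (by simp)⟩, fun _ i hi => absurd hi (by simp),
    fun hc => ⟨X', ?_, by simp, fun i hi => absurd hi (by simp)⟩⟩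
  have h1 := h.norm_sub_est_le hc
  have h2 : ‖X‖ ≤ ‖X - Z.est‖ + ‖Z.est‖ := by simpa using norm_add_le (X - Z.est) Z.est
  -- The origin of `2 + b`: the estimate counts twice, and the error adds `b * s * Z.bound`.
  have h3 : ‖X‖ + ‖Z.est‖ ≤ s * ((2 + D.b) * (‖Z.est‖ + Z.bound)) := by
    have := D.b_nonneg
    have : 0 ≤ (s - 1) * ‖Z.est‖ := mul_nonneg (by linarith) (norm_nonneg _)
    have : 0 ≤ s * (D.b * ‖Z.est‖) := by positivity
    have : 0 ≤ s * Z.bound := by positivity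
    nlinarith
  calc ‖X'‖ ≤ D.c₀ * (‖X‖ + ‖Z.est‖) := hX'
    _ ≤ D.c₀ * (s * ((2 + D.b) * (‖Z.est‖ + Z.bound))) :=
        mul_le_mul_of_nonneg_left h3 D.c₀_pos.le
    _ = s * (D.c₀ * (2 + D.b) * (‖Z.est‖ + Z.bound)) := by ring
    _ ≤ s * (D.c * (‖Z.est‖ + Z.bound)) := by
        have := D.le_c
        gcongr

theorem norm_le_of_forall_block {η r : ℕ} {v : ℕ → Fin r → ℝ} {R : ℝ} (hR : 0 ≤ R)
    (h : ∀ i < η, ‖v i‖ ≤ R) : ‖fun i : Fin η × Fin r => v i.1 i.2‖ ≤ R :=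
  (pi_norm_le_iff_of_nonneg hR).2 fun i => (norm_le_pi_norm (v i.1) i.2).trans (h _ i.1.2)

/-- The memory stays consistent with the plant over a sampling period without switch, before the
state is captured. -/
theorem Consistent.step_search (hN : Odd N) {D : Design Mode n r N} {s : ℝ} (hs : 1 ≤ s) {p : Mode}
    {X X' : Fin n → ℝ} {Z : Memory n r} (h : Consistent D s p X Z) (hc : Z.captured = false)
    (hX' : X' - (D.mode p).Φ Z.est = (D.mode p).Ψ (X - Z.est)) :
    Consistent D s p X' (step D p p (symbolValue N r
      (quantize hN (radius D p Z) ((D.mode p).C (X - Z.est)))) Z) := by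
  have hE := h.bound_pos
  have hcE : 0 < D.c * Z.bound := mul_pos D.c_pos hE
  have hle : Z.bound ≤ D.c * Z.bound := le_mul_of_one_le_left hE.le D.one_le_c
  have hN1 : N ≠ 1 := fun h1 => by simp [h.of_one h1] at hc
  have hN' : (N : ℝ) ≠ 0 := by exact_mod_cast hN.pos.ne'
  have hR := radius_pos hN h
  have hrad : radius D p Z / N = Z.bound := by
    rw [radius, hc]
    simp [hN']
  set u := symbolValue N r (quantize hN (radius D p Z) ((D.mode p).C (X - Z.est))) with hu
  obtain ⟨z, hz, hzi⟩ := h.search hc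
  rw [h.est_eq_zero hc, map_zero, sub_zero, sub_zero] at hX'
  have hX'z : X' = ((D.mode p).Ψ ^ (Z.pos + 1)) z := by
    rw [hX', hz, pow_succ', mul_apply_eq_comp]
  have hnew : u = 0 → ∀ i < Z.pos + 1, ‖(D.mode p).C (((D.mode p).Ψ ^ i) z)‖ ≤ Z.bound := by
    intro hu0 i hi
    rcases Nat.lt_succ_iff_lt_or_eq.1 hi with hi | rfl
    · exact hzi i hi
    · have := norm_le_of_quantize_eq_zero hN hR hN1 hu0
      rwa [hrad, h.est_eq_zero hc, sub_zero, hz] at this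
  rw [step, if_pos rfl, hc]
  simp only [Bool.false_eq_true, if_false]
  split_ifs with hu0 hend
  · refine ⟨(D.mode p).η_pos, hcE, fun _ => rfl, by simp, by simp,
      fun _ i hi => absurd hi (by simp), fun _ => ⟨X', ?_, by simp,
      fun i hi => absurd hi (by simp)⟩⟩
    change ‖X'‖ ≤ s * (D.c * Z.bound)
    -- `G` reconstructs the new state from the `η` outputs of the run, all bounded by the old
    -- `Z.bound`; this justifies capture with estimate zero.
    rw [hX'z, hend, ← (D.mode p).G_outputs]
    have hv := norm_le_of_forall_block (η := (D.mode p).η) hE.le (hend ▸ hnew hu0)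
    refine (((D.mode p).G.le_of_opNorm_le (D.norm_G_le p) _).trans
      (mul_le_mul_of_nonneg_left hv D.c_pos.le)).trans (le_mul_of_one_le_left hcE.le hs)
  · refine ⟨?_, hcE, fun h1 => absurd h1 hN1, fun _ => rfl,
      fun _ => ⟨z, hX'z, fun i hi => (hnew hu0 i hi).trans hle⟩, by simp, by simp⟩
    have := h.pos_lt
    change Z.pos + 1 < _
    omega
  · exact ⟨(D.mode p).η_pos, hcE, fun h1 => absurd h1 hN1, fun _ => rfl,
      fun _ => ⟨X', by simp, fun i hi => absurd hi (by simp)⟩, by simp, by simp⟩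

theorem norm_update_le {r : ℕ} {v : ℕ → Fin r → ℝ} {w : Fin r → ℝ} {R : ℝ} {l : ℕ}
    (h : ∀ i < l, ‖v i‖ ≤ R) (hw : ‖w‖ ≤ R) : ∀ i < l + 1, ‖Function.update v l w i‖ ≤ R := by
  intro i hi
  rcases eq_or_ne i l with rfl | hne
  · rwa [Function.update_self]
  · rw [Function.update_of_ne hne]
    exact h i (by omega)

theorem norm_smul_le_of_norm_le_one {r : ℕ} {R : ℝ} (hR : 0 ≤ R) {u : Fin r → ℝ} (hu : ‖u‖ ≤ 1) :
    ‖R • u‖ ≤ R := by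
  rw [norm_smul, Real.norm_of_nonneg hR]
  exact mul_le_of_le_one_right hR hu

/-- The memory stays consistent with the plant over a sampling period without switch, after the
state is captured. -/
theorem Consistent.step_track (hN : Odd N) {D : Design Mode n r N} {s : ℝ} (hs : 1 ≤ s)
    (hs1 : N = 1 ∨ s = 1) {p : Mode}
    {X X' : Fin n → ℝ} {Z : Memory n r} (h : Consistent D s p X Z) (hc : Z.captured = true)
    (hX' : X' - (D.mode p).Φ Z.est = (D.mode p).Ψ (X - Z.est)) :
    Consistent D s p X' (step D p p (symbolValue N r
      (quantize hN (radius D p Z) ((D.mode p).C (X - Z.est)))) Z) := by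
  have hE := h.bound_pos
  have hN' : (0 : ℝ) < N := by exact_mod_cast hN.pos
  have hR := radius_pos hN h
  have hrad : radius D p Z = (D.mode p).μ * Z.bound := by
    rw [radius, hc, if_pos rfl]
  rw [hrad] at hR ⊢
  set u := symbolValue N r (quantize hN ((D.mode p).μ * Z.bound) ((D.mode p).C (X - Z.est)))
    with hu
  obtain ⟨z, hz, hXz, hzi⟩ := h.track hc
  have hX'z : X' - (D.mode p).Φ Z.est = ((D.mode p).Ψ ^ (Z.pos + 1)) z := by
    rw [hX', hXz, pow_succ', mul_apply_eq_comp]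
  set v := Function.update Z.outputs Z.pos (((D.mode p).μ * Z.bound) • u) with hv
  have hvn : ∀ i < Z.pos + 1, ‖v i‖ ≤ (D.mode p).μ * Z.bound :=
    norm_update_le (h.norm_outputs_le hc)
      (norm_smul_le_of_norm_le_one hR.le (norm_symbolValue_le_one _))
  have hvz : ∀ i < Z.pos + 1, ‖(D.mode p).C (((D.mode p).Ψ ^ i) z) - v i‖ ≤
      s * ((D.mode p).μ * Z.bound) / N := by
    intro i hi
    rcases eq_or_ne i Z.pos with rfl | hne
    · rw [hv, Function.update_self, ← hXz]
      refine norm_sub_quantize_le hN hR hs1 ?_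
      rw [hXz]
      refine ((D.mode p).norm_output_le _ h.pos_lt z).trans ?_
      calc (D.mode p).μ * ‖z‖ ≤ (D.mode p).μ * (s * Z.bound) :=
            mul_le_mul_of_nonneg_left hz (D.mode p).μ_pos.le
        _ = s * ((D.mode p).μ * Z.bound) := by ring
    · rw [hv, Function.update_of_ne hne]
      exact hzi i (by omega)
  rw [step, if_pos rfl, hc, if_pos rfl, ← hv]
  split_ifs with hend
  · refine ⟨(D.mode p).η_pos, mul_pos (pow_pos (D.mode p).ϑ_pos _) hE, fun _ => rfl, by simp,
      by simp, fun _ i hi => absurd hi (by simp), fun _ => ⟨_, ?_, (by simp; rfl),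
      fun i hi => absurd hi (by simp)⟩⟩
    change ‖X' - ((D.mode p).Φ Z.est + _)‖ ≤ s * ((D.mode p).ϑ ^ (D.mode p).η * Z.bound)
    -- By linearity the new error is `G` applied to the quantization errors of the block.
    rw [← sub_sub, hX'z, hend, ← (D.mode p).G_outputs, ← map_sub]
    have hnn : 0 ≤ s * ((D.mode p).μ * Z.bound) / N := by positivity
    have hbl := norm_le_of_forall_block (η := (D.mode p).η)
      (v := fun i => (D.mode p).C (((D.mode p).Ψ ^ i) z) - v i) hnn (hend ▸ hvz)
    refine ((D.mode p).G.le_opNorm_of_le hbl).trans ?_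
    rw [mul_div_assoc', div_le_iff₀ hN']
    have := mul_le_mul_of_nonneg_right (D.mode p).norm_G_mul_le
      (mul_nonneg (zero_le_one.trans hs) hE.le)
    linarith
  · refine ⟨?_, hE, fun _ => rfl, by simp, by simp, fun _ => hvn, fun _ => ⟨z, hz, hX'z, hvz⟩⟩
    have := h.pos_lt
    change Z.pos + 1 < _
    omega

/-! ### The Lyapunov function -/

/-- The Lyapunov function of the controller. -/
def lyapunov (D : Design Mode n r N) (p : Mode) (Z : Memory n r) : ℝ :=
  -- The bound is constant along a block; the weight spreads its contraction at the end evenly over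
  -- the samples.
  (D.mode p).g Z.est + (D.mode p).κ * Z.bound * (D.mode p).ϑ ^ Z.pos

theorem ModeData.κ_pos (d : ModeData n r N) : 0 < d.κ :=
  pos_of_mul_pos_left (one_pos.trans_le d.one_le_κ_mul) (pow_pos d.ϑ_pos _).le

theorem ModeData.ϑ_le_one (d : ModeData n r N) : d.ϑ ≤ 1 := d.ϑ_le_lam.trans d.lam_lt_one.le

theorem ModeData.lam_pos (d : ModeData n r N) : 0 < d.lam := d.ϑ_pos.trans_le d.ϑ_le_lam

theorem Consistent.norm_est_add_bound_le {D : Design Mode n r N} {s : ℝ} {p : Mode}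
    {X : Fin n → ℝ} {Z : Memory n r} (h : Consistent D s p X Z) :
    ‖Z.est‖ + Z.bound ≤ lyapunov D p Z := by
  refine add_le_add ((D.mode p).norm_le_g _) ?_
  have h1 : (D.mode p).ϑ ^ (D.mode p).η ≤ (D.mode p).ϑ ^ Z.pos :=
    pow_le_pow_of_le_one (D.mode p).ϑ_pos.le (D.mode p).ϑ_le_one h.pos_lt.le
  have h2 : 1 ≤ (D.mode p).κ * (D.mode p).ϑ ^ Z.pos :=
    (D.mode p).one_le_κ_mul.trans (mul_le_mul_of_nonneg_left h1 (D.mode p).κ_pos.le)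
  have := mul_le_mul_of_nonneg_left h2 h.bound_pos.le
  linarith

theorem Consistent.lyapunov_pos {D : Design Mode n r N} {s : ℝ} {p : Mode}
    {X : Fin n → ℝ} {Z : Memory n r} (h : Consistent D s p X Z) : 0 < lyapunov D p Z :=
  (add_pos_of_nonneg_of_pos (norm_nonneg _) h.bound_pos).trans_le h.norm_est_add_bound_le

/-- Inside a block `Φ` contracts the gauge and the weight gains a factor `ϑ`. At the end of the
block the weight returns to `1`, and `g_G_le` pays for the jump of the estimate. -/
theorem Consistent.lyapunov_step_le {D : Design Mode n r N} {s : ℝ} {p : Mode}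
    {X : Fin n → ℝ} {Z : Memory n r} (h : Consistent D s p X Z) (hc : Z.captured = true)
    {u : Fin r → ℝ} (hu : ‖u‖ ≤ 1) :
    lyapunov D p (step D p p u Z) ≤ D.lam * lyapunov D p Z := by
  have hE := h.bound_pos
  refine le_trans ?_ (mul_le_mul_of_nonneg_right (D.le_lam p) h.lyapunov_pos.le)
  have hR : 0 ≤ (D.mode p).μ * Z.bound := (mul_pos (D.mode p).μ_pos hE).le
  have hvn := norm_update_le (h.norm_outputs_le hc) (norm_smul_le_of_norm_le_one hR hu)
  have hg := (D.mode p).g_Φ_le Z.est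
  rw [step, if_pos rfl, hc, if_pos rfl]
  split_ifs with hend
  · have h1 := norm_le_of_forall_block (η := (D.mode p).η) hR (hend ▸ hvn)
    have h2 := (D.mode p).g_G_le _ _ hE.le h1
    have h3 := (D.mode p).g_add_le ((D.mode p).Φ Z.est) ((D.mode p).G
      (fun i => Function.update Z.outputs Z.pos (((D.mode p).μ * Z.bound) • u) i.1 i.2))
    have h4 : (D.mode p).η - 1 = Z.pos := by omega
    rw [h4] at h2
    simp only [lyapunov, pow_zero, mul_one]
    linarith
  · simp only [lyapunov, pow_succ]
    have hκ := (D.mode p).κ_pos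
    have : (D.mode p).κ * Z.bound * (D.mode p).ϑ ^ Z.pos * (D.mode p).ϑ ≤
        (D.mode p).κ * Z.bound * (D.mode p).ϑ ^ Z.pos * (D.mode p).lam :=
      mul_le_mul_of_nonneg_left (D.mode p).ϑ_le_lam
        (mul_pos (mul_pos hκ hE) (pow_pos (D.mode p).ϑ_pos _)).le
    linarith

/-- Mode changes and search steps leave the estimate zero and a bound of at most `c * (‖Z.est‖ +
Z.bound)`; all other steps decrease the function. -/
theorem Consistent.lyapunov_step_le_mul {D : Design Mode n r N} {s : ℝ} {p p' : Mode}
    {X : Fin n → ℝ} {Z : Memory n r} (h : Consistent D s p X Z) {u : Fin r → ℝ} (hu : ‖u‖ ≤ 1) :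
    lyapunov D p' (step D p p' u Z) ≤ D.H * lyapunov D p Z := by
  have hE := h.bound_pos
  have hV := h.lyapunov_pos
  have hEV := h.norm_est_add_bound_le
  have hH : D.c * (D.mode p').κ ≤ D.H := by
    have := D.le_H p'
    have := mul_pos D.c_pos (D.mode p').κ_pos
    linarith
  have key : ∀ (t : Bool) (l : ℕ) (E : ℝ), 0 ≤ E → E ≤ ‖Z.est‖ + Z.bound →
      lyapunov D p' ⟨t, l, 0, 0, D.c * E⟩ ≤ D.H * lyapunov D p Z := by
    intro t l E hE0 hE
    simp only [lyapunov, (D.mode p').g_zero, zero_add]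
    have h1 : (D.mode p').ϑ ^ l ≤ 1 := pow_le_one₀ (D.mode p').ϑ_pos.le (D.mode p').ϑ_le_one
    have h2 : 0 ≤ (D.mode p').κ * (D.c * E) :=
      mul_nonneg (D.mode p').κ_pos.le (mul_nonneg D.c_pos.le hE0)
    calc _ ≤ (D.mode p').κ * (D.c * E) := mul_le_of_le_one_right h2 h1
      _ = D.c * (D.mode p').κ * E := by ring
      _ ≤ D.H * lyapunov D p Z :=
        mul_le_mul hH (hE.trans hEV) hE0 (zero_le_one.trans D.one_le_H)
  by_cases hp : p' = p
  · subst hp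
    rcases hc : Z.captured with _ | _
    · have hle : Z.bound ≤ ‖Z.est‖ + Z.bound := le_add_of_nonneg_left (norm_nonneg _)
      rw [step, if_pos rfl, hc]
      simp only [Bool.false_eq_true, if_false]
      split_ifs
      · exact key _ _ _ hE.le hle
      · exact key _ _ _ hE.le hle
      · exact key _ _ _ hE.le hle
    · exact (h.lyapunov_step_le hc hu).trans
        (mul_le_mul_of_nonneg_right (D.lam_lt_one.le.trans D.one_le_H) hV.le)
  · rw [step, if_neg hp]
    exact key _ _ _ (by positivity) le_rfl

/-! ### Sampled trajectories of the closed loop -/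

/-- The states `X k` of the plant at the sampling times, where `p` are the sampled modes and `q`
the transmitted symbols. -/
structure IsSampledTrajectory (D : Design Mode n r N) (hN : Odd N) (p : ℕ → Mode)
    (X : ℕ → Fin n → ℝ) (q : ℕ → Fin (N ^ r)) : Prop where
  symbol : ∀ k, q k = quantize hN (radius D (p k) (memory D p q k))
    ((D.mode (p k)).C (X k - (memory D p q k).est))
  norm_succ_le : ∀ k, ‖X (k + 1)‖ ≤ D.c₀ * (‖X k‖ + ‖(memory D p q k).est‖)
  succ_sub : ∀ k, p (k + 1) = p k → X (k + 1) - (D.mode (p k)).Φ (memory D p q k).est =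
    (D.mode (p k)).Ψ (X k - (memory D p q k).est)

open Classical in
/-- The number of mode changes in the first `k` sampling periods. -/
def numChanges (p : ℕ → Mode) (k : ℕ) : ℕ :=
  ((Finset.range k).filter fun j => p (j + 1) ≠ p j).card

theorem numChanges_succ_of_eq {p : ℕ → Mode} {k : ℕ} (h : p (k + 1) = p k) :
    numChanges p (k + 1) = numChanges p k := by
  rw [numChanges, Finset.range_add_one, Finset.filter_insert, if_neg (by simpa using h), numChanges]

theorem numChanges_succ_of_ne {p : ℕ → Mode} {k : ℕ} (h : p (k + 1) ≠ p k) :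
    numChanges p (k + 1) = numChanges p k + 1 := by
  rw [numChanges, Finset.range_add_one, Finset.filter_insert, if_pos h,
    Finset.card_insert_of_notMem (by simp), numChanges]

namespace IsSampledTrajectory

variable {D : Design Mode n r N} {hN : Odd N} {p : ℕ → Mode} {X : ℕ → Fin n → ℝ}
  {q : ℕ → Fin (N ^ r)}

/-- The scale `s` serves the case of a single level, where the nominal initial bound `1` may be too
small for the state; for `N ≠ 1` the search finds a true bound. -/
theorem consistent (h : IsSampledTrajectory D hN p X q) {s : ℝ} (hs : 1 ≤ s) (hs1 : N = 1 ∨ s = 1)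
    (h0 : N = 1 → ‖X 0‖ ≤ s) (k : ℕ) : Consistent D s (p k) (X k) (memory D p q k) := by
  induction k with
  | zero =>
    refine ⟨(D.mode _).η_pos, one_pos, fun h1 => decide_eq_true h1, fun _ => rfl,
      fun _ => ⟨X 0, by simp [memory], fun i hi => absurd hi (Nat.not_lt_zero i)⟩,
      fun _ i hi => absurd hi (Nat.not_lt_zero i),
      fun hc => ⟨X 0, ?_, by simp [memory], fun i hi => absurd hi (Nat.not_lt_zero i)⟩⟩
    change _ ≤ s * 1
    rw [mul_one]
    exact h0 (of_decide_eq_true hc)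
  | succ k ih =>
    rw [memory]
    by_cases hp : p (k + 1) = p k
    · have hsub := h.succ_sub k hp
      rw [hp, h.symbol k]
      rcases hc : (memory D p q k).captured with _ | _
      · exact ih.step_search hN hs hc hsub
      · exact ih.step_track hN hs hs1 hc hsub
    · exact ih.step_of_ne hs hp _ (h.norm_succ_le k)

/-- A scale at which the memory is consistent with the trajectory. -/
theorem exists_consistent (h : IsSampledTrajectory D hN p X q) :
    ∃ s : ℝ, 1 ≤ s ∧ ∀ k, Consistent D s (p k) (X k) (memory D p q k) := by
  by_cases h1 : N = 1
  · exact ⟨max 1 ‖X 0‖, le_max_left _ _,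
      h.consistent (le_max_left _ _) (Or.inl h1) fun _ => le_max_right _ _⟩
  · exact ⟨1, le_rfl, h.consistent le_rfl (Or.inr rfl) fun h2 => absurd h2 h1⟩

end IsSampledTrajectory

/-! ### Length of the search phase -/

theorem captured_step (D : Design Mode n r N) {p p' : Mode} {u : Fin r → ℝ} {Z : Memory n r}
    (h : Z.captured = true) : (step D p p' u Z).captured = true := by
  rw [step, h]
  simp only [if_true]
  split_ifs <;> rfl

theorem captured_of_le (D : Design Mode n r N) {p : ℕ → Mode} {q : ℕ → Fin (N ^ r)} {j k : ℕ}
    (hjk : j ≤ k) (h : (memory D p q j).captured = true) : (memory D p q k).captured = true := by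
  induction k, hjk using Nat.le_induction with
  | base => exact h
  | succ k _ ih => exact captured_step D ih

theorem captured_eq_false_of_succ (D : Design Mode n r N) {p : ℕ → Mode} {q : ℕ → Fin (N ^ r)}
    {k : ℕ} (h : (memory D p q (k + 1)).captured = false) :
    (memory D p q k).captured = false := by
  rcases hc : (memory D p q k).captured with _ | _
  · rfl
  · rw [captured_of_le D k.le_succ hc] at h
    exact absurd h (by simp)

namespace IsSampledTrajectory

variable {D : Design Mode n r N} {hN : Odd N} {p : ℕ → Mode} {X : ℕ → Fin n → ℝ}
  {q : ℕ → Fin (N ^ r)}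

/-- The estimate, hence the input, vanishes during the search, so only the plant's own growth
competes with the factor `c` of the bound. -/
theorem search_growth (h : IsSampledTrajectory D hN p X q) {k : ℕ}
    (hc : (memory D p q k).captured = false) :
    (memory D p q k).bound = D.c ^ k ∧ ‖X k‖ ≤ D.c₀ ^ k * ‖X 0‖ := by
  obtain ⟨s, -, hcons⟩ := h.exists_consistent
  induction k with
  | zero => simp [memory]
  | succ k ih =>
    have hck := captured_eq_false_of_succ D hc
    obtain ⟨hb, hX⟩ := ih hck
    have hest := (hcons k).est_eq_zero hck
    constructor
    · have hstep : (memory D p q (k + 1)).bound = D.c * (memory D p q k).bound := by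
        rw [memory, step, hck, hest]
        simp only [Bool.false_eq_true, if_false, norm_zero, zero_add]
        split_ifs <;> rfl
      rw [hstep, hb, pow_succ']
    · have := h.norm_succ_le k
      rw [hest, norm_zero, add_zero] at this
      calc ‖X (k + 1)‖ ≤ D.c₀ * (D.c₀ ^ k * ‖X 0‖) :=
            this.trans (mul_le_mul_of_nonneg_left hX D.c₀_pos.le)
        _ = D.c₀ ^ (k + 1) * ‖X 0‖ := by rw [pow_succ']; ring

/-- While the state is not captured, mode changes keep recurring. -/
theorem search_length (h : IsSampledTrajectory D hN p X q) {k₀ : ℕ}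
    (h0 : ∀ k ≥ k₀, D.b * (D.c₀ ^ k * ‖X 0‖) ≤ D.c ^ k) {k : ℕ}
    (hc : (memory D p q k).captured = false) :
    k ≤ k₀ + (memory D p q k).pos + D.η * numChanges p k := by
  obtain ⟨s, -, hcons⟩ := h.exists_consistent
  induction k with
  | zero => omega
  | succ k ih =>
    have hck := captured_eq_false_of_succ D hc
    have hk := ih hck
    obtain ⟨hb, hX⟩ := h.search_growth hck
    have hest := (hcons k).est_eq_zero hck
    have hpos := (hcons k).pos_lt
    have hη := D.le_η (p k)
    by_cases hp : p (k + 1) = p k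
    · rw [numChanges_succ_of_eq hp]
      rcases lt_or_ge k k₀ with hlt | hge
      · omega
      -- From `k₀` on the outputs stay in the central cell, so without a mode change the position
      -- advances.
      have hu : symbolValue N r (q k) = 0 := by
        rw [h.symbol k]
        refine quantize_eq_zero hN (radius_pos hN (hcons k)) ?_
        have hN' : (N : ℝ) ≠ 0 := by exact_mod_cast hN.pos.ne'
        rw [radius, hck, hest, sub_zero, hb]
        simp only [Bool.false_eq_true, if_false]
        rw [mul_div_cancel_left₀ _ hN']
        exact (((D.mode (p k)).C.le_of_opNorm_le (D.norm_C_le _) _).trans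
          (mul_le_mul_of_nonneg_left hX D.b_nonneg)).trans (h0 k hge)
      have hstep : (memory D p q (k + 1)).pos = (memory D p q k).pos + 1 := by
        rw [memory, step, if_pos hp, hck, hu] at hc ⊢
        simp only [Bool.false_eq_true, if_false, if_true] at hc ⊢
        split_ifs at hc ⊢
        rfl
      omega
    -- A mode change wastes the current run and its own period, at most `η` periods together.
    · rw [numChanges_succ_of_ne hp, Nat.mul_add]
      omega

/-- The growth of the Lyapunov function in terms of the number of mode changes, when the state is
captured after `K` steps. -/
theorem lyapunov_le (h : IsSampledTrajectory D hN p X q) {K : ℕ}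
    (hK : ∀ k ≥ K, (memory D p q k).captured = true) (k : ℕ) :
    lyapunov D (p k) (memory D p q k) ≤
      D.H * ((D.H / D.lam) ^ (numChanges p k + K) * D.lam ^ k) := by
  obtain ⟨s, -, hcons⟩ := h.exists_consistent
  have hl := D.lam_pos
  have hH : 0 < D.H := one_pos.trans_le D.one_le_H
  have hHl : 1 ≤ D.H / D.lam := (one_le_div hl).2 (D.lam_lt_one.le.trans D.one_le_H)
  -- Every mode change and every period before `K` may cost `H` instead of `lam`, hence a factor `H
  -- / lam`; `min k K` counts the latter periods so far.
  suffices hs : lyapunov D (p k) (memory D p q k) ≤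
      D.H * ((D.H / D.lam) ^ (numChanges p k + min k K) * D.lam ^ k) by
    refine hs.trans ?_
    gcongr
    exact min_le_right _ _
  induction k with
  | zero =>
    have h1 := D.le_H (p 0)
    have h2 := D.one_le_c
    have h3 := mul_le_mul_of_nonneg_right h2 (D.mode (p 0)).κ_pos.le
    have h4 := (D.mode (p 0)).κ_pos
    simp only [lyapunov, memory, (D.mode (p 0)).g_zero, numChanges]
    simp only [Finset.range_zero, Finset.filter_empty, Finset.card_empty, Nat.zero_min, add_zero,
      pow_zero, mul_one, zero_add]
    linarith
  | succ k ih =>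
    have hu := norm_symbolValue_le_one (q k)
    have hgen : lyapunov D (p (k + 1)) (memory D p q (k + 1)) ≤
        D.H * ((D.H / D.lam) ^ (numChanges p k + min k K + 1) * D.lam ^ (k + 1)) := by
      rw [memory]
      refine ((hcons k).lyapunov_step_le_mul hu).trans
        ((mul_le_mul_of_nonneg_left ih hH.le).trans (le_of_eq ?_))
      rw [pow_succ, pow_succ]
      field_simp
    by_cases hp : p (k + 1) = p k
    · rw [numChanges_succ_of_eq hp]
      rcases lt_or_ge k K with hlt | hge
      · rw [min_eq_left (show k + 1 ≤ K from hlt), ← add_assoc]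
        rwa [min_eq_left hlt.le] at hgen
      · rw [min_eq_right (by omega)]
        rw [min_eq_right hge] at ih
        rw [memory, hp]
        refine ((hcons k).lyapunov_step_le (hK k hge) hu).trans
          ((mul_le_mul_of_nonneg_left ih hl.le).trans (le_of_eq ?_))
        rw [pow_succ]
        ring
    · rw [numChanges_succ_of_ne hp]
      have hmin : min k K ≤ min (k + 1) K := min_le_min_right _ k.le_succ
      exact hgen.trans (mul_le_mul_of_nonneg_left (mul_le_mul_of_nonneg_right
        (pow_le_pow_right₀ hHl (by omega)) (pow_pos hl _).le) hH.le)

end IsSampledTrajectory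

/-! ### Decay and convergence for rare mode changes -/

theorem Consistent.norm_add_le {D : Design Mode n r N} {s : ℝ} (hs : 1 ≤ s) {p : Mode}
    {X : Fin n → ℝ} {Z : Memory n r} (hcons : Consistent D s p X Z) (hc : Z.captured = true) :
    ‖X‖ + ‖Z.est‖ ≤ s * (D.b + 2) * lyapunov D p Z := by
  have hV := hcons.norm_est_add_bound_le
  have h1 := hcons.norm_sub_est_le hc
  have h2 : ‖X‖ ≤ ‖X - Z.est‖ + ‖Z.est‖ := by
    simpa using _root_.norm_add_le (X - Z.est) Z.est
  have hE := hcons.bound_pos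
  have hn := norm_nonneg Z.est
  have hb := D.b_nonneg
  have h3 : 0 ≤ s * (D.b + 2) := by positivity
  refine le_trans ?_ (mul_le_mul_of_nonneg_left hV h3)
  have : 0 ≤ (s - 1) * ‖Z.est‖ := mul_nonneg (by linarith) hn
  have : 0 ≤ s * (D.b * ‖Z.est‖) := by positivity
  have : 0 ≤ s * Z.bound := by positivity
  nlinarith

/-- The mode changes are rare enough, at an average rate of at most `α` per step. -/
structure Design.AdmissibleRate (D : Design Mode n r N) (α : ℝ) : Prop where
  nonneg : 0 ≤ α
  -- This keeps half of the decay exponent after paying for mode changes; `mul_η_le` keeps half of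
  -- the periods for the search.
  mul_log_le : α * Real.log (D.H / D.lam) ≤ -Real.log D.lam / 2
  mul_η_le : α * D.η ≤ 1 / 2

/-- The decaying bound on the Lyapunov function. -/
def decayBound (D : Design Mode n r N) (B : ℝ) (k : ℕ) : ℝ :=
  D.H * Real.exp (B * Real.log (D.H / D.lam)) * Real.exp (Real.log D.lam / 2) ^ k

theorem tendsto_decayBound (D : Design Mode n r N) (B : ℝ) :
    Tendsto (decayBound D B) atTop (𝓝 0) := by
  have h1 : Real.exp (Real.log D.lam / 2) < 1 := by
    rw [Real.exp_lt_one_iff]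
    have := Real.log_neg D.lam_pos D.lam_lt_one
    linarith
  have h2 := (tendsto_pow_atTop_nhds_zero_of_lt_one (Real.exp_pos _).le h1).const_mul
    (D.H * Real.exp (B * Real.log (D.H / D.lam)))
  rwa [mul_zero] at h2

namespace IsSampledTrajectory

variable {D : Design Mode n r N} {hN : Odd N} {p : ℕ → Mode} {X : ℕ → Fin n → ℝ}
  {q : ℕ → Fin (N ^ r)}

/-- Otherwise `search_length` gives `k ≤ k₀ + η + η (N₀ + k α)`, and `α η ≤ 1 / 2` absorbs half of
`k`. -/
theorem captured_of_rate (h : IsSampledTrajectory D hN p X q) {α : ℝ} (hα : D.AdmissibleRate α)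
    {N₀ : ℕ} (hp : ∀ k, (numChanges p k : ℝ) ≤ N₀ + k * α) {k₀ : ℕ}
    (h0 : ∀ k ≥ k₀, D.b * (D.c₀ ^ k * ‖X 0‖) ≤ D.c ^ k) :
    ∀ k ≥ 2 * (k₀ + D.η + D.η * N₀) + 1, (memory D p q k).captured = true := by
  intro k hk
  by_contra hc
  rw [Bool.not_eq_true] at hc
  obtain ⟨s, -, hcons⟩ := h.exists_consistent
  have h1 := h.search_length h0 hc
  have h2 : (memory D p q k).pos ≤ D.η := (hcons k).pos_lt.le.trans (D.le_η _)
  have h3 : (k : ℝ) ≤ k₀ + D.η + D.η * numChanges p k := by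
    exact_mod_cast h1.trans (by gcongr)
  have h4 : (D.η : ℝ) * numChanges p k ≤ D.η * (N₀ + k * α) :=
    mul_le_mul_of_nonneg_left (hp k) (Nat.cast_nonneg _)
  have h5 : (k : ℝ) * (α * D.η) ≤ k * (1 / 2) :=
    mul_le_mul_of_nonneg_left hα.mul_η_le (Nat.cast_nonneg _)
  have h6 : (2 * ((k₀ : ℝ) + D.η + D.η * N₀) + 1) ≤ k := by exact_mod_cast hk
  linarith

theorem lyapunov_le_decayBound (h : IsSampledTrajectory D hN p X q) {α : ℝ}
    (hα : D.AdmissibleRate α) {N₀ : ℕ} (hp : ∀ k, (numChanges p k : ℝ) ≤ N₀ + k * α) {K : ℕ}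
    (hK : ∀ k ≥ K, (memory D p q k).captured = true) (k : ℕ) :
    lyapunov D (p k) (memory D p q k) ≤ decayBound D (N₀ + K) k := by
  refine (h.lyapunov_le hK k).trans ?_
  have hl := D.lam_pos
  have hH : 0 < D.H := one_pos.trans_le D.one_le_H
  have hHl : 1 ≤ D.H / D.lam := (one_le_div hl).2 (D.lam_lt_one.le.trans D.one_le_H)
  have hHl0 : 0 < D.H / D.lam := one_pos.trans_le hHl
  rw [decayBound, mul_assoc]
  refine mul_le_mul_of_nonneg_left ?_ hH.le
  rw [← Real.exp_nat_mul, ← Real.exp_add]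
  nth_rewrite 1 [← Real.exp_log hHl0]
  nth_rewrite 2 [← Real.exp_log hl]
  rw [← Real.exp_nat_mul, ← Real.exp_nat_mul, ← Real.exp_add, Real.exp_le_exp]
  have hlog := Real.log_nonneg hHl
  have h1 : ((numChanges p k + K : ℕ) : ℝ) * Real.log (D.H / D.lam) ≤
      (N₀ + k * α + K) * Real.log (D.H / D.lam) := by
    refine mul_le_mul_of_nonneg_right ?_ hlog
    push_cast
    linarith [hp k]
  have h2 : (k : ℝ) * (α * Real.log (D.H / D.lam)) ≤ k * (-Real.log D.lam / 2) :=
    mul_le_mul_of_nonneg_left hα.mul_log_le (Nat.cast_nonneg _)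
  linarith

/-- Sampled trajectories converge. -/
theorem tendsto_zero (h : IsSampledTrajectory D hN p X q) {α : ℝ}
    (hα : D.AdmissibleRate α) {N₀ : ℕ} (hp : ∀ k, (numChanges p k : ℝ) ≤ N₀ + k * α) :
    Tendsto (fun k => ‖X k‖ + ‖(memory D p q k).est‖) atTop (𝓝 0) := by
  obtain ⟨s, hs, hcons⟩ := h.exists_consistent
  -- Since `c ≥ 2 c₀`, the search bound gains a factor `2` per step on the state.
  have hev : ∀ᶠ k in atTop, D.b * ‖X 0‖ < (2 : ℝ) ^ k :=
    (tendsto_pow_atTop_atTop_of_one_lt one_lt_two).eventually_gt_atTop _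
  obtain ⟨k₀, hk₀⟩ := eventually_atTop.1 hev
  have h0 : ∀ k ≥ k₀, D.b * (D.c₀ ^ k * ‖X 0‖) ≤ D.c ^ k := by
    intro k hk
    calc D.b * (D.c₀ ^ k * ‖X 0‖) = D.b * ‖X 0‖ * D.c₀ ^ k := by ring
      _ ≤ 2 ^ k * D.c₀ ^ k :=
        mul_le_mul_of_nonneg_right (hk₀ k hk).le (pow_pos D.c₀_pos k).le
      _ = (2 * D.c₀) ^ k := (mul_pow _ _ _).symm
      _ ≤ D.c ^ k := pow_le_pow_left₀ (by linarith [D.c₀_pos]) D.two_mul_c₀_le k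
  set K := 2 * (k₀ + D.η + D.η * N₀) + 1
  have hK := h.captured_of_rate hα hp h0
  have hlim := (tendsto_decayBound D (N₀ + K)).const_mul (s * (D.b + 2))
  rw [mul_zero] at hlim
  refine tendsto_of_tendsto_of_tendsto_of_le_of_le' tendsto_const_nhds hlim
    (Eventually.of_forall fun k => by positivity) ?_
  filter_upwards [eventually_ge_atTop K] with k hk
  have := D.b_nonneg
  exact ((hcons k).norm_add_le hs (hK k hk)).trans
    (mul_le_mul_of_nonneg_left (h.lyapunov_le_decayBound hα hp hK k) (by positivity))

end IsSampledTrajectory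

/-- Zero symbols create no estimate, and the bound shrinks at most by `a` per step, so the central
cell cannot collapse quickly onto a small state. -/
theorem step_of_zero (D : Design Mode n r N) {p p' : Mode} {Z : Memory n r} (hest : Z.est = 0)
    (hout : Z.outputs = 0) (hE : 0 ≤ Z.bound) :
    (step D p p' 0 Z).est = 0 ∧ (step D p p' 0 Z).outputs = 0 ∧
      D.a * Z.bound ≤ (step D p p' 0 Z).bound := by
  have h1 : D.a * Z.bound ≤ Z.bound := mul_le_of_le_one_left hE D.a_le_one
  have h2 : Z.bound ≤ D.c * Z.bound := le_mul_of_one_le_left hE D.one_le_c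
  have h3 : D.a * Z.bound ≤ D.c * Z.bound := h1.trans h2
  have h4 : D.a * Z.bound ≤ (D.mode p).ϑ ^ (D.mode p).η * Z.bound :=
    mul_le_mul_of_nonneg_right (D.a_le_ϑ p) hE
  have hG : (D.mode p).G (fun _ => 0) = 0 := map_zero _
  have hup : Function.update (0 : ℕ → Fin r → ℝ) Z.pos 0 = 0 := Function.update_eq_self _ _
  rw [step, hest, hout, smul_zero, hup]
  split_ifs <;> simp [hG, h1, h3, h4]

namespace IsSampledTrajectory

variable {D : Design Mode n r N} {hN : Odd N} {p : ℕ → Mode} {X : ℕ → Fin n → ℝ}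
  {q : ℕ → Fin (N ^ r)}

/-- For a small initial state, all transmitted values vanish for a long time. -/
theorem est_eq_zero_of_small (h : IsSampledTrajectory D hN p X q) {T : ℕ}
    (hT : D.b * (D.c₀ ^ T * ‖X 0‖) ≤ D.a ^ (T + 1)) {k : ℕ} (hk : k ≤ T) :
    (memory D p q k).est = 0 ∧ (memory D p q k).outputs = 0 ∧
      D.a ^ k ≤ (memory D p q k).bound ∧ ‖X k‖ ≤ D.c₀ ^ k * ‖X 0‖ := by
  obtain ⟨s, -, hcons⟩ := h.exists_consistent
  induction k with
  | zero => simp [memory]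
  | succ k ih =>
    obtain ⟨hest, hout, hb, hX⟩ := ih (by omega)
    have hE := (hcons k).bound_pos
    have hN' : (0 : ℝ) < N := by exact_mod_cast hN.pos
    have hu : symbolValue N r (q k) = 0 := by
      rw [h.symbol k]
      refine quantize_eq_zero hN (radius_pos hN (hcons k)) ?_
      have h1 : D.a * (memory D p q k).bound ≤ radius D (p k) (memory D p q k) / N := by
        rw [le_div_iff₀ hN', radius]
        split_ifs
        · have := mul_le_mul_of_nonneg_right (D.a_le_μ (p k)) hE.le
          linarith
        · have := mul_le_mul_of_nonneg_right D.a_le_one (mul_pos hN' hE).le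
          linarith
      refine le_trans ?_ h1
      rw [hest, sub_zero]
      calc ‖(D.mode (p k)).C (X k)‖ ≤ D.b * (D.c₀ ^ k * ‖X 0‖) :=
            ((D.mode (p k)).C.le_of_opNorm_le (D.norm_C_le _) _).trans
              (mul_le_mul_of_nonneg_left hX D.b_nonneg)
        _ ≤ D.b * (D.c₀ ^ T * ‖X 0‖) := by
            have := D.b_nonneg
            have := D.one_le_c₀
            gcongr
            omega
        _ ≤ D.a ^ (T + 1) := hT
        _ ≤ D.a ^ (k + 1) := pow_le_pow_of_le_one D.a_pos.le D.a_le_one (by omega)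
        _ = D.a * D.a ^ k := pow_succ' _ _
        _ ≤ _ := mul_le_mul_of_nonneg_left hb D.a_pos.le
    obtain ⟨h1, h2, h3⟩ := step_of_zero D (p := p k) (p' := p (k + 1)) hest hout hE.le
    rw [← hu] at h1 h2 h3
    refine ⟨h1, h2, ?_, ?_⟩
    · rw [pow_succ']
      exact (mul_le_mul_of_nonneg_left hb D.a_pos.le).trans h3
    · have := h.norm_succ_le k
      rw [hest, norm_zero, add_zero] at this
      calc ‖X (k + 1)‖ ≤ D.c₀ * (D.c₀ ^ k * ‖X 0‖) :=
            this.trans (mul_le_mul_of_nonneg_left hX D.c₀_pos.le)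
        _ = D.c₀ ^ (k + 1) * ‖X 0‖ := by rw [pow_succ']; ring

end IsSampledTrajectory

/-- Sampled trajectories are stable, uniformly in the modes. -/
theorem Design.stable (D : Design Mode n r N) (hN : Odd N) {α : ℝ} (hα : D.AdmissibleRate α)
    (N₀ : ℕ) {ε : ℝ} (hε : 0 < ε) :
    ∃ δ : ℝ, 0 < δ ∧ ∀ p X q, IsSampledTrajectory D hN p X q →
      (∀ k, (numChanges p k : ℝ) ≤ N₀ + k * α) → ‖X 0‖ ≤ δ →
      ∀ k, ‖X k‖ + ‖(memory D p q k).est‖ ≤ ε := by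
  have hb := D.b_nonneg
  have hc₀ := D.c₀_pos
  -- For small initial states the search bound dominates the outputs from the start, so `k₀ = 0` and
  -- `K` is uniform.
  set K := 2 * (0 + D.η + D.η * N₀) + 1 with hKdef
  have hlim := (tendsto_decayBound D (N₀ + K)).const_mul (1 * (D.b + 2))
  rw [mul_zero] at hlim
  obtain ⟨T₀, hT₀⟩ := eventually_atTop.1 (hlim.eventually (gt_mem_nhds hε))
  set T := max T₀ K
  have hcT : 0 < D.c₀ ^ T := pow_pos hc₀ T
  have haT : 0 < D.a ^ (T + 1) := pow_pos D.a_pos _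
  -- The three terms give consistency at scale `1`, zero symbols up to time `T`, and `c₀ ^ T * ‖X 0‖
  -- ≤ ε`.
  refine ⟨min 1 (min (D.a ^ (T + 1) / ((D.b + 1) * D.c₀ ^ T)) (ε / D.c₀ ^ T)), by positivity,
    fun p X q h hp hX k => ?_⟩
  have hX1 : ‖X 0‖ ≤ 1 := hX.trans (min_le_left _ _)
  have hX2 : ‖X 0‖ ≤ D.a ^ (T + 1) / ((D.b + 1) * D.c₀ ^ T) :=
    hX.trans ((min_le_right _ _).trans (min_le_left _ _))
  have hX3 : ‖X 0‖ ≤ ε / D.c₀ ^ T :=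
    hX.trans ((min_le_right _ _).trans (min_le_right _ _))
  rw [le_div_iff₀ (by positivity)] at hX2 hX3
  have hsmall : D.b * (D.c₀ ^ T * ‖X 0‖) ≤ D.a ^ (T + 1) := by
    have : 0 ≤ ‖X 0‖ * D.c₀ ^ T := by positivity
    linarith
  rcases le_or_gt k T with hk | hk
  · obtain ⟨hest, -, -, hXk⟩ := h.est_eq_zero_of_small hsmall hk
    rw [hest, norm_zero, add_zero]
    refine hXk.trans (le_trans ?_ hX3)
    rw [mul_comm]
    have := D.one_le_c₀
    gcongr
  · have h0 : ∀ k ≥ 0, D.b * (D.c₀ ^ k * ‖X 0‖) ≤ D.c ^ k := by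
      intro k _
      have h1 : D.b * ‖X 0‖ ≤ 1 := by
        have h2 : 1 ≤ D.c₀ ^ T := one_le_pow₀ D.one_le_c₀
        have h3 : D.b * ‖X 0‖ ≤ D.b * (D.c₀ ^ T * ‖X 0‖) :=
          mul_le_mul_of_nonneg_left (le_mul_of_one_le_left (norm_nonneg _) h2) hb
        exact h3.trans (hsmall.trans (pow_le_one₀ D.a_pos.le D.a_le_one))
      calc D.b * (D.c₀ ^ k * ‖X 0‖) = D.b * ‖X 0‖ * D.c₀ ^ k := by ring
        _ ≤ 1 * D.c₀ ^ k := mul_le_mul_of_nonneg_right h1 (pow_pos hc₀ k).le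
        _ ≤ D.c ^ k := by
          rw [one_mul]
          exact pow_le_pow_left₀ hc₀.le (by linarith [D.two_mul_c₀_le]) k
    have hK := h.captured_of_rate hα hp h0
    have hKk : K ≤ k := (le_max_right T₀ K).trans hk.le
    have hcons := h.consistent le_rfl (Or.inr rfl) (fun _ => hX1) k
    refine (hcons.norm_add_le le_rfl (hK k hKk)).trans (le_trans ?_
      (hT₀ k ((le_max_left T₀ K).trans hk.le)).le)
    exact mul_le_mul_of_nonneg_left (h.lyapunov_le_decayBound hα hp hK k) (by positivity)

/-! ### Switching signals -/

/-- A signal without switching times in `(a, b]` is constant on `[a, b]`. -/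
theorem IsSwitchingSignal.eq_of_disjoint {σ : ℝ → Mode} (hσ : IsSwitchingSignal σ) {a b : ℝ}
    (ha : 0 ≤ a) (h : ∀ t ∈ Ioc a b, t ∉ switchingTimes σ) : ∀ t ∈ Icc a b, σ t = σ a := by
  -- For discrete modes, absence of switching times is continuity, and intervals are connected.
  let _ : TopologicalSpace Mode := ⊥
  have : DiscreteTopology Mode := ⟨rfl⟩
  have hcont : ContinuousOn σ (Icc a b) := by
    intro t ht
    rw [ContinuousWithinAt, nhds_discrete, tendsto_pure]
    rcases eq_or_lt_of_le ht.1 with rfl | hlt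
    · have h1 : ∀ᶠ s in 𝓝[≥] a, σ s = σ a := by
        rw [← Ioi_insert, nhdsWithin_insert]
        exact eventually_sup.2 ⟨by simp, hσ.right_continuous a ha⟩
      exact h1.filter_mono (nhdsWithin_mono _ Icc_subset_Ici_self)
    · have h1 := h t ⟨hlt, ht.2⟩
      simp only [switchingTimes, mem_ofPred_eq, not_and, not_not] at h1
      exact (h1 (ha.trans_lt hlt)).filter_mono nhdsWithin_le_nhds
  intro t ht
  exact isPreconnected_Icc.constant hcont ht ⟨le_rfl, ht.1.trans ht.2⟩

/-- On an interval with at most one switching time, a signal takes first its initial and then its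
final value. -/
theorem IsSwitchingSignal.exists_switch {σ : ℝ → Mode} (hσ : IsSwitchingSignal σ) {a b : ℝ}
    (ha : 0 ≤ a) (hab : a < b) (h : numSwitches σ b a ≤ 1) :
    ∃ s ∈ Ioc a b, (∀ t ∈ Ico a s, σ t = σ a) ∧ ∀ t ∈ Icc s b, σ t = σ b := by
  have hfin : (switchingTimes σ ∩ Ioc a b).Finite :=
    (hσ.finite_switches b).subset (inter_subset_inter_right _ (Ioc_subset_Ioc_left ha))
  rcases (switchingTimes σ ∩ Ioc a b).eq_empty_or_nonempty with he | ⟨s, hs, hsab⟩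
  · have hc := hσ.eq_of_disjoint (b := b) ha fun t ht ht' =>
      (he.subset ⟨ht', ht⟩ : t ∈ (∅ : Set ℝ))
    refine ⟨b, ⟨hab, le_rfl⟩, fun t ht => hc t ⟨ht.1, ht.2.le⟩, fun t ht => ?_⟩
    rw [le_antisymm ht.2 ht.1]
  · have huniq : ∀ t ∈ Ioc a b, t ∈ switchingTimes σ → t = s := fun t ht ht' =>
      (ncard_le_one hfin).1 h t ⟨ht', ht⟩ s ⟨hs, hsab⟩
    have hright := hσ.eq_of_disjoint (a := s) (b := b) (ha.trans hsab.1.le) fun t ht ht' =>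
      ht.1.ne' (huniq t ⟨hsab.1.trans ht.1, ht.2⟩ ht')
    refine ⟨s, hsab, fun t ht => ?_, fun t ht => ?_⟩
    · exact hσ.eq_of_disjoint (b := t) ha (fun u hu hu' => (hu.2.trans_lt ht.2).ne
        (huniq u ⟨hu.1, (hu.2.trans_lt ht.2).le.trans hsab.2⟩ hu')) t ⟨ht.1, le_rfl⟩
    · rw [hright t ht, hright b ⟨hsab.2, le_rfl⟩]

/-- Every change of the sampled mode accounts for a switching time. -/
theorem IsSwitchingSignal.numChanges_le {σ : ℝ → Mode} (hσ : IsSwitchingSignal σ) {τ : ℝ}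
    (hτ : 0 < τ) (k : ℕ) :
    numChanges (fun j : ℕ => σ (j * τ)) k ≤ numSwitches σ (k * τ) 0 := by
  classical
  have hex : ∀ j : ℕ, σ ((j + 1 : ℕ) * τ) ≠ σ (j * τ) →
      ∃ t ∈ Ioc (j * τ) ((j + 1 : ℕ) * τ), t ∈ switchingTimes σ := by
    intro j hj
    by_contra! hcon
    have hle : (j : ℝ) * τ ≤ (j + 1 : ℕ) * τ := by
      gcongr
      exact j.le_succ
    exact hj (hσ.eq_of_disjoint (by positivity) hcon _ ⟨hle, le_rfl⟩)
  choose! f hf hfs using hex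
  rw [numChanges, numSwitches, ← ncard_coe_finset]
  refine ncard_le_ncard_of_injOn f (fun j hj => ?_) (fun i hi j hj hij => ?_)
    (hσ.finite_switches _)
  · simp only [Finset.coe_filter, Finset.mem_range, mem_ofPred_eq] at hj
    refine ⟨hfs j hj.2, (hf j hj.2).1.trans_le' (by positivity), (hf j hj.2).2.trans ?_⟩
    gcongr
    exact hj.1
  · simp only [Finset.coe_filter, Finset.mem_range, mem_ofPred_eq] at hi hj
    have h1 := hf i hi.2
    have h2 := hf j hj.2
    rw [hij] at h1
    have h3 : (j : ℝ) < (i + 1 : ℕ) := lt_of_mul_lt_mul_right (h2.1.trans_le h1.2) hτ.le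
    have h4 : (i : ℝ) < (j + 1 : ℕ) := lt_of_mul_lt_mul_right (h1.1.trans_le h2.2) hτ.le
    have h5 : j < i + 1 := by exact_mod_cast h3
    have h6 : i < j + 1 := by exact_mod_cast h4
    omega

/-! ### Linear differential equations -/

/-- The linear flow `e^{tM}`. -/
def flow {n : ℕ} (M : Matrix (Fin n) (Fin n) ℝ) (t : ℝ) : (Fin n → ℝ) →L[ℝ] (Fin n → ℝ) :=
  LinearMap.toContinuousLinearMap (NormedSpace.exp (t • M)).mulVecLin

theorem flow_apply (M : Matrix (Fin n) (Fin n) ℝ) (t : ℝ) (v : Fin n → ℝ) :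
    flow M t v = (NormedSpace.exp (t • M)).mulVec v := rfl

theorem flow_zero (M : Matrix (Fin n) (Fin n) ℝ) : flow M 0 = 1 := by
  ext1 v
  simp [flow_apply]

theorem flow_add (M : Matrix (Fin n) (Fin n) ℝ) (s t : ℝ) :
    flow M (s + t) = flow M s * flow M t := by
  ext1 v
  rw [mul_apply_eq_comp, flow_apply, flow_apply, flow_apply, Matrix.mulVec_mulVec, add_smul,
    Matrix.exp_add_of_commute _ _ (((Commute.refl M).smul_left s).smul_right t)]

theorem flow_natCast_mul (M : Matrix (Fin n) (Fin n) ℝ) (k : ℕ) (t : ℝ) :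
    flow M (k * t) = flow M t ^ k := by
  induction k with
  | zero => simp [flow_zero]
  | succ k ih => rw [Nat.cast_succ, add_mul, one_mul, flow_add, ih, pow_succ]

theorem IsHurwitz.exists_norm_flow_pow_le {F : Matrix (Fin n) (Fin n) ℝ} (hF : IsHurwitz F)
    {τ : ℝ} (hτ : 0 < τ) :
    ∃ (j : ℕ) (ρ : ℝ), 0 < j ∧ 0 < ρ ∧ ρ < 1 ∧ ‖flow F τ ^ j‖ ≤ ρ ^ j := by
  obtain ⟨j, ρ, hj, hρ0, hρ1, hρ⟩ := hF.exists_norm_pow_le hτ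
  refine ⟨j, ρ, hj, hρ0, hρ1, ContinuousLinearMap.opNorm_le_bound _ (by positivity) fun v => ?_⟩
  rw [← flow_natCast_mul, flow_apply, mul_smul, Nat.cast_smul_eq_nsmul, Matrix.exp_nsmul]
  exact (Matrix.linfty_opNorm_mulVec _ _).trans (mul_le_mul_of_nonneg_right hρ (norm_nonneg _))

theorem hasDerivAt_flow (M : Matrix (Fin n) (Fin n) ℝ) (t : ℝ) :
    HasDerivAt (flow M) (LinearMap.toContinuousLinearMap M.mulVecLin * flow M t) t := by
  let L : Matrix (Fin n) (Fin n) ℝ →ₗ[ℝ] ((Fin n → ℝ) →L[ℝ] (Fin n → ℝ)) :=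
    LinearMap.toContinuousLinearMap.toLinearMap ∘ₗ Matrix.toLin'.toLinearMap
  have h := (LinearMap.toContinuousLinearMap L).hasFDerivAt.comp_hasDerivAt t
    (hasDerivAt_exp_smul_const' M t)
  convert! h using 1
  ext1 v
  change M.mulVec ((NormedSpace.exp (t • M)).mulVec v) = (M * NormedSpace.exp (t • M)).mulVec v
  rw [Matrix.mulVec_mulVec]

theorem continuous_flow (M : Matrix (Fin n) (Fin n) ℝ) : Continuous (flow M) :=
  continuous_iff_continuousAt.2 fun t => (hasDerivAt_flow M t).continuousAt

theorem hasDerivAt_flow_apply (M : Matrix (Fin n) (Fin n) ℝ) (v : Fin n → ℝ) (a t : ℝ) :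
    HasDerivAt (fun s => flow M (s - a) v) (M.mulVec (flow M (t - a) v)) t := by
  have h := ((hasDerivAt_flow M (t - a)).comp_sub_const t a).clm_apply (hasDerivAt_const t v)
  rwa [map_zero, add_zero] at h

/-- Variation of constants. -/
theorem exists_linear_solution (M : Matrix (Fin n) (Fin n) ℝ) {f : ℝ → Fin n → ℝ}
    (hf : Continuous f) (a : ℝ) (x₀ : Fin n → ℝ) :
    ∃ x : ℝ → Fin n → ℝ, x a = x₀ ∧ ∀ t, HasDerivAt x (M.mulVec (x t) + f t) t := by
  have hg : Continuous fun s => flow M (-(s - a)) (f s) :=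
    ((continuous_flow M).comp (by fun_prop)).clm_apply hf
  refine ⟨fun t => flow M (t - a) (x₀ + ∫ s in a..t, flow M (-(s - a)) (f s)), ?_, fun t => ?_⟩
  · simp [flow_zero]
  · have h1 := (hg.integral_hasStrictDerivAt a t).hasDerivAt.const_add x₀
    have h2 := ((hasDerivAt_flow M (t - a)).comp_sub_const t a).clm_apply h1
    convert! h2 using 1
    have h3 : flow M (t - a) (flow M (-(t - a)) (f t)) = f t := by
      rw [← mul_apply_eq_comp, ← flow_add, add_neg_cancel, flow_zero, one_apply_eq_self]
    rw [h3]
    rfl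

/-! ### The plant between two sampling times -/

theorem exists_forall_le_of_finite {ι : Type*} [Finite ι] (f : ι → ℝ) (a : ℝ) :
    ∃ b, a ≤ b ∧ ∀ i, f i ≤ b := by
  obtain ⟨b, hb⟩ := (finite_range f).bddAbove
  exact ⟨max a b, le_max_left _ _, fun i => (hb ⟨i, rfl⟩).trans (le_max_right _ _)⟩

/-- The right-hand side of the plant equation when the plant is in mode `p'` and the controller,
started at `ξ` at time `a`, is in mode `p`. -/
def plantField (sys : SwitchedSystem Mode n m r) (K : Mode → Matrix (Fin m) (Fin n) ℝ)
    (p p' : Mode) (a : ℝ) (ξ : Fin n → ℝ) (t : ℝ) (x : Fin n → ℝ) : Fin n → ℝ :=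
  (sys.A p').mulVec x +
    (sys.B p').mulVec ((K p).mulVec (flow (sys.A p + sys.B p * K p) (t - a) ξ))

theorem exists_input_bound [Finite Mode] (sys : SwitchedSystem Mode n m r)
    (K : Mode → Matrix (Fin m) (Fin n) ℝ) (τ : ℝ) :
    ∃ β, 1 ≤ β ∧ ∀ p p' ξ, ∀ s ∈ Icc 0 τ,
      ‖(sys.B p').mulVec ((K p).mulVec (flow (sys.A p + sys.B p * K p) s ξ))‖ ≤ β * ‖ξ‖ := by
  have h : ∀ pp : Mode × Mode, ∃ b, ∀ ξ, ∀ s ∈ Icc 0 τ,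
      ‖(sys.B pp.2).mulVec ((K pp.1).mulVec
        (flow (sys.A pp.1 + sys.B pp.1 * K pp.1) s ξ))‖ ≤ b * ‖ξ‖ := by
    rintro ⟨p, p'⟩
    obtain ⟨b, hb⟩ := isCompact_Icc.exists_bound_of_continuousOn (s := Icc 0 τ)
      (continuous_flow (sys.A p + sys.B p * K p)).continuousOn
    refine ⟨‖sys.B p' * K p‖ * b, fun ξ s hs => ?_⟩
    rw [Matrix.mulVec_mulVec, mul_assoc]
    exact (Matrix.linfty_opNorm_mulVec _ _).trans (mul_le_mul_of_nonneg_left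
      ((flow _ s).le_of_opNorm_le (hb s hs) ξ) (norm_nonneg _))
  choose b hb using h
  obtain ⟨β, hβ1, hβ⟩ := exists_forall_le_of_finite b 1
  exact ⟨β, hβ1, fun p p' ξ s hs => (hb (p, p') ξ s hs).trans
    (mul_le_mul_of_nonneg_right (hβ _) (norm_nonneg _))⟩

/-- Grönwall's inequality with the largest `‖A_p‖` as rate; the bound does not see when or how the
signal switches. -/
theorem exists_growth_bound [Finite Mode] (sys : SwitchedSystem Mode n m r)
    (K : Mode → Matrix (Fin m) (Fin n) ℝ) (τ : ℝ) :
    ∃ c₀, 1 ≤ c₀ ∧ ∀ (σ : ℝ → Mode) (p : Mode) (a : ℝ) (ξ : Fin n → ℝ) (x : ℝ → Fin n → ℝ),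
      ContinuousOn x (Icc a (a + τ)) →
      (∀ t ∈ Ico a (a + τ),
        HasDerivWithinAt x (plantField sys K p (σ t) a ξ t (x t)) (Ici t) t) →
      ∀ t ∈ Icc a (a + τ), ‖x t‖ ≤ c₀ * (‖x a‖ + ‖ξ‖) := by
  obtain ⟨β, hβ1, hβ⟩ := exists_input_bound sys K τ
  obtain ⟨α, hα1, hα⟩ := exists_forall_le_of_finite (fun p => ‖sys.A p‖) 1
  have hα0 : 0 < α := one_pos.trans_le hα1
  refine ⟨max 1 (Real.exp (α * τ) * β), le_max_left _ _, fun σ p a ξ x hx hx' t ht => ?_⟩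
  have h := norm_le_gronwallBound_of_norm_deriv_right_le (K := α) (ε := β * ‖ξ‖) hx hx' le_rfl
    (fun s hs => (norm_add_le _ _).trans (add_le_add
      ((Matrix.linfty_opNorm_mulVec _ _).trans
        (mul_le_mul_of_nonneg_right (hα _) (norm_nonneg _)))
      (hβ p (σ s) ξ (s - a) ⟨by linarith [hs.1], by linarith [hs.2]⟩))) t ht
  refine h.trans (le_trans ?_ (mul_le_mul_of_nonneg_right (le_max_right _ _) (by positivity)))
  rw [gronwallBound_of_K_ne_0 hα0.ne']
  have h1 : Real.exp (α * (t - a)) ≤ Real.exp (α * τ) := by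
    rw [Real.exp_le_exp]
    exact mul_le_mul_of_nonneg_left (by linarith [ht.2]) hα0.le
  have h2 : 1 ≤ Real.exp (α * (t - a)) := Real.one_le_exp (mul_nonneg hα0.le (by linarith [ht.1]))
  have h3 : β * ‖ξ‖ / α ≤ β * ‖ξ‖ := div_le_self (by positivity) hα1
  calc ‖x a‖ * Real.exp (α * (t - a)) + β * ‖ξ‖ / α * (Real.exp (α * (t - a)) - 1)
      ≤ ‖x a‖ * Real.exp (α * τ) + β * ‖ξ‖ * Real.exp (α * τ) := by
        gcongr
        linarith
    _ = Real.exp (α * τ) * (1 * ‖x a‖ + β * ‖ξ‖) := by ring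
    _ ≤ Real.exp (α * τ) * (β * ‖x a‖ + β * ‖ξ‖) := by gcongr
    _ = Real.exp (α * τ) * β * (‖x a‖ + ‖ξ‖) := by ring

/-- Without a switch, the estimation error evolves in open loop. -/
theorem sub_flow_eq_of_no_switch (sys : SwitchedSystem Mode n m r)
    (K : Mode → Matrix (Fin m) (Fin n) ℝ) {τ : ℝ} (hτ : 0 ≤ τ) (p : Mode) (a : ℝ) (ξ : Fin n → ℝ)
    {x : ℝ → Fin n → ℝ} (hx : ContinuousOn x (Icc a (a + τ)))
    (hx' : ∀ t ∈ Ico a (a + τ),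
      HasDerivWithinAt x (plantField sys K p p a ξ t (x t)) (Ici t) t) :
    x (a + τ) - flow (sys.A p + sys.B p * K p) τ ξ = flow (sys.A p) τ (x a - ξ) := by
  set F := sys.A p + sys.B p * K p with hF
  have hlip : ∀ _ : ℝ, LipschitzWith ‖sys.A p‖₊ fun v => (sys.A p).mulVec v := fun _ =>
    LipschitzWith.of_dist_le_mul fun v w => by
      rw [dist_eq_norm, dist_eq_norm, ← Matrix.mulVec_sub]
      exact Matrix.linfty_opNorm_mulVec _ _
  have hF' := hasDerivAt_flow_apply F ξ a
  have hA' := hasDerivAt_flow_apply (sys.A p) (x a - ξ) a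
  -- The common input `B K ξ` cancels in `x - ξ`, so both functions solve `ė = A_p e` from the same
  -- value.
  have key := ODE_solution_unique (v := fun _ v => (sys.A p).mulVec v)
    (f := fun t => x t - flow F (t - a) ξ) (g := fun t => flow (sys.A p) (t - a) (x a - ξ))
    (a := a) (b := a + τ) hlip
    (hx.sub fun t _ => (hF' t).continuousAt.continuousWithinAt)
    (fun t ht => by
      have := (hx' t ht).sub (hF' t).hasDerivWithinAt
      convert! this using 1
      rw [plantField, ← hF, Matrix.mulVec_sub]
      nth_rewrite 3 [hF]
      rw [Matrix.add_mulVec, ← Matrix.mulVec_mulVec]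
      abel)
    (fun t _ => (hA' t).continuousAt.continuousWithinAt)
    (fun t _ => (hA' t).hasDerivWithinAt)
    (by simp [flow_zero])
  simpa using key ⟨by linarith, le_rfl⟩

/-- The period contains at most one switch, so two linear solutions are glued there. -/
theorem exists_plant_solution (sys : SwitchedSystem Mode n m r)
    (K : Mode → Matrix (Fin m) (Fin n) ℝ) {σ : ℝ → Mode} (hσ : IsSwitchingSignal σ) {τ : ℝ}
    (hτ : 0 < τ) (hdw : HasDwellTime σ τ) (p : Mode) {a : ℝ} (ha : 0 ≤ a) (ξ x₀ : Fin n → ℝ) :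
    ∃ x : ℝ → Fin n → ℝ, Continuous x ∧ x a = x₀ ∧ ∀ t ∈ Ico a (a + τ),
      HasDerivWithinAt x (plantField sys K p (σ t) a ξ t (x t)) (Ici t) t := by
  obtain ⟨s, hs, hs1, hs2⟩ := hσ.exists_switch (b := a + τ) ha (by linarith)
    (hdw a (a + τ) ha (by linarith) (by linarith))
  set F := sys.A p + sys.B p * K p with hF
  have hu : ∀ p' : Mode, Continuous fun t =>
      (sys.B p').mulVec ((K p).mulVec (flow F (t - a) ξ)) := fun p' =>
    Continuous.matrix_mulVec continuous_const (Continuous.matrix_mulVec continuous_const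
      (((continuous_flow F).comp (by fun_prop)).clm_apply continuous_const))
  obtain ⟨x₁, h1a, h1⟩ := exists_linear_solution (sys.A (σ a)) (hu (σ a)) a x₀
  obtain ⟨x₂, h2s, h2⟩ := exists_linear_solution (sys.A (σ (a + τ))) (hu (σ (a + τ))) s (x₁ s)
  have hc1 : Continuous x₁ := continuous_iff_continuousAt.2 fun t => (h1 t).continuousAt
  have hc2 : Continuous x₂ := continuous_iff_continuousAt.2 fun t => (h2 t).continuousAt
  refine ⟨fun t => if t ≤ s then x₁ t else x₂ t,
    hc1.if_le hc2 continuous_id continuous_const fun t ht => by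
      rw [show t = s from ht]; exact h2s.symm, ?_, fun t ht => ?_⟩
  · simp only
    rw [if_pos hs.1.le, h1a]
  · rcases lt_or_ge t s with hts | hts
    · have hev : (fun t => if t ≤ s then x₁ t else x₂ t) =ᶠ[𝓝[≥] t] x₁ := by
        filter_upwards [nhdsWithin_le_nhds (Iio_mem_nhds hts)] with u hu
        rw [if_pos (le_of_lt hu)]
      have := (h1 t).hasDerivWithinAt (s := Ici t)
      simp only
      rw [hs1 t ⟨ht.1, hts⟩, if_pos hts.le]
      exact this.congr_of_eventuallyEq hev (if_pos hts.le)
    · have heq : ∀ u ∈ Ici t, (fun t => if t ≤ s then x₁ t else x₂ t) u = x₂ u := by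
        intro u hu
        rcases eq_or_lt_of_le (hts.trans hu) with rfl | hlt
        · simp only [le_refl, if_true]
          exact h2s.symm
        · simp only
          rw [if_neg (not_le.2 hlt)]
      have := (h2 t).hasDerivWithinAt (s := Ici t)
      have h3 : (if t ≤ s then x₁ t else x₂ t) = x₂ t := heq t self_mem_Ici
      simp only
      rw [hs2 t ⟨hts, ht.2.le⟩, h3]
      exact this.congr heq (heq t self_mem_Ici)

/-! ### Trajectories and their samples -/

theorem floor_div_eq {τ : ℝ} (hτ : 0 < τ) {k : ℕ} {t : ℝ} (ht : t ∈ Ico (k * τ) (k * τ + τ)) :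
    ⌊t / τ⌋₊ = k := by
  have h0 : 0 ≤ t := ht.1.trans' (by positivity)
  rw [Nat.floor_eq_iff (by positivity), le_div_iff₀ hτ, div_lt_iff₀ hτ]
  exact ⟨ht.1, by linarith [ht.2]⟩

theorem mem_Ico_floor_div {τ : ℝ} (hτ : 0 < τ) {t : ℝ} (ht : 0 ≤ t) :
    t ∈ Ico (⌊t / τ⌋₊ * τ) (⌊t / τ⌋₊ * τ + τ) := by
  have h1 := Nat.floor_le (div_nonneg ht hτ.le)
  have h2 := Nat.lt_floor_add_one (t / τ)
  rw [le_div_iff₀ hτ] at h1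
  rw [div_lt_iff₀ hτ] at h2
  exact ⟨h1, by linarith⟩

theorem control_eq (sys : SwitchedSystem Mode n m r) (K : Mode → Matrix (Fin m) (Fin n) ℝ)
    {τ : ℝ} (hτ : 0 < τ) (S : Strategy Mode n r N) (σ : ℝ → Mode) (q : ℕ → Fin (N ^ r)) {k : ℕ}
    {t : ℝ} (ht : t ∈ Ico (k * τ) (k * τ + τ)) :
    control sys K τ S σ q t = (K (σ (k * τ))).mulVec
      (flow (sys.A (σ (k * τ)) + sys.B (σ (k * τ)) * K (σ (k * τ))) (t - k * τ)
        (S.decode k (fun i => q i) (fun i => σ (i * τ)))) := by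
  rw [control, estimate, floor_div_eq hτ ht, flow_apply]

/-- Sequences generated by a feedback that depends on the whole past of one of them. -/
theorem exists_feedback_sequence {Q V : Type*} [Nonempty Q] (enc : (k : ℕ) → V → (Fin k → Q) → Q)
    (next : (k : ℕ) → V → (Fin (k + 1) → Q) → V) (x₀ : V) :
    ∃ (q : ℕ → Q) (X : ℕ → V), X 0 = x₀ ∧ (∀ k, q k = enc k (X k) fun i => q i) ∧
      ∀ k, X (k + 1) = next k (X k) fun i => q i := by
  let upd : (k : ℕ) → (ℕ → Q) × V → ℕ → Q := fun k s =>
    Function.update s.1 k (enc k s.2 fun i => s.1 i)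
  -- Entries below `k` of the stored sequence are final at stage `k`; the others are placeholders.
  let st : ℕ → (ℕ → Q) × V := fun k => Nat.rec (Classical.ofNonempty, x₀)
    (fun k s => (upd k s, next k s.2 fun i => upd k s i)) k
  have hst : ∀ k, st (k + 1) = (upd k (st k), next k (st k).2 fun i => upd k (st k) i) :=
    fun _ => rfl
  set q : ℕ → Q := fun k => (st (k + 1)).1 k with hq
  have hcoh : ∀ k, ∀ i < k, (st k).1 i = q i := by
    intro k
    induction k with
    | zero => simp
    | succ k ih =>
      intro i hi
      rcases Nat.lt_succ_iff_lt_or_eq.1 hi with hlt | rfl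
      · rw [hst, ← ih i hlt]
        exact Function.update_of_ne hlt.ne _ _
      · rfl
  refine ⟨q, fun k => (st k).2, rfl, fun k => ?_, fun k => ?_⟩
  · have h1 : q k = enc k (st k).2 fun i => (st k).1 i := by
      rw [hq]
      simp only [hst]
      exact Function.update_self _ _ _
    rw [h1]
    congr 1
    funext i
    exact hcoh k i i.2
  · change (st (k + 1)).2 = _
    have h2 : (fun i : Fin (k + 1) => q i) = fun i : Fin (k + 1) => upd k (st k) i := by
      funext i
      rw [← hcoh (k + 1) i i.2, hst]
    rw [h2, hst]

/-- The closed loop has a trajectory from every initial state. -/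
theorem exists_isTrajectory (sys : SwitchedSystem Mode n m r)
    (K : Mode → Matrix (Fin m) (Fin n) ℝ) {τ : ℝ} (hτ : 0 < τ) (hN : 0 < N)
    (S : Strategy Mode n r N) {σ : ℝ → Mode} (hσ : IsSwitchingSignal σ) (hdw : HasDwellTime σ τ)
    (x₀ : Fin n → ℝ) : ∃ x, IsTrajectory sys K τ S σ x ∧ x 0 = x₀ := by
  have hk0 : ∀ k : ℕ, 0 ≤ (k : ℝ) * τ := fun k => by positivity
  have hsol : ∀ (k : ℕ) (ξ y : Fin n → ℝ), _ := fun k ξ y =>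
    exists_plant_solution sys K hσ hτ hdw (σ (k * τ)) (hk0 k) ξ y
  choose sol hcont hinit hder using hsol
  have : Nonempty (Fin (N ^ r)) := ⟨⟨0, pow_pos hN r⟩⟩
  obtain ⟨q, X, hX0, hq, hX⟩ := exists_feedback_sequence
    (fun k y (qs : Fin k → Fin (N ^ r)) =>
      S.encode k ((sys.C (σ (k * τ))).mulVec y) qs (fun i => σ (i * τ)))
    (fun k y qs => sol k (S.decode k qs fun i => σ (i * τ)) y ((k + 1 : ℕ) * τ)) x₀
  set z : ℕ → ℝ → Fin n → ℝ := fun k =>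
    sol k (S.decode k (fun i => q i) fun i => σ (i * τ)) (X k) with hz
  set x : ℝ → Fin n → ℝ := fun t => z ⌊t / τ⌋₊ t with hx
  have hxk : ∀ k : ℕ, ∀ t ∈ Ico (k * τ) (k * τ + τ), x t = z k t := fun k t ht => by
    rw [hx]
    simp only
    rw [floor_div_eq hτ ht]
  have hmem : ∀ k : ℕ, (k : ℝ) * τ ∈ Ico (k * τ) (k * τ + τ) := fun k => ⟨le_rfl, by linarith⟩
  have hxX : ∀ k : ℕ, x (k * τ) = X k := fun k => by
    rw [hxk k _ (hmem k)]
    exact hinit _ _ _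
  have hsucc : ∀ k : ℕ, ((k + 1 : ℕ) : ℝ) * τ = k * τ + τ := fun k => by push_cast; ring
  have hxIcc : ∀ k : ℕ, ∀ t ∈ Icc (k * τ) (k * τ + τ), x t = z k t := fun k t ht => by
    rcases eq_or_lt_of_le ht.2 with rfl | hlt
    · rw [← hsucc, hxX, hX]
    · exact hxk k t ⟨ht.1, hlt⟩
  have hcontIcc : ∀ k : ℕ, ContinuousOn x (Icc 0 (k * τ)) := by
    intro k
    induction k with
    | zero => simp
    | succ k ih =>
      rw [hsucc, ← Icc_union_Icc_eq_Icc (hk0 k) (show (k : ℝ) * τ ≤ k * τ + τ by linarith)]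
      exact ih.union_of_isClosed ((hcont _ _ _).continuousOn.congr (hxIcc k)) isClosed_Icc
        isClosed_Icc
  refine ⟨x, ⟨q, fun k => ?_, fun t ht => ?_, fun t ht => ?_⟩, ?_⟩
  · rw [hq k, hxX]
  · obtain ⟨k, hk⟩ := exists_nat_gt (t / τ)
    rw [div_lt_iff₀ hτ] at hk
    refine (hcontIcc k t ⟨ht, hk.le⟩).mono_of_mem_nhdsWithin ?_
    rw [← Ici_inter_Iic]
    exact inter_mem self_mem_nhdsWithin (nhdsWithin_le_nhds (Iic_mem_nhds hk))
  · set k := ⌊t / τ⌋₊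
    have htk : t ∈ Ico (k * τ) (k * τ + τ) := mem_Ico_floor_div hτ ht
    have hev : x =ᶠ[𝓝[≥] t] z k := by
      filter_upwards [self_mem_nhdsWithin, nhdsWithin_le_nhds (Iio_mem_nhds htk.2)] with u h1 h2
      exact hxk k u ⟨htk.1.trans h1, h2⟩
    have := hder k (S.decode k (fun i => q i) fun i => σ (i * τ)) (X k) t htk
    rw [control_eq sys K hτ S σ q htk, hxk k t htk]
    exact this.congr_of_eventuallyEq hev (hxk k t htk)
  · have := hxX 0
    rwa [Nat.cast_zero, zero_mul, hX0] at this

/-! ### The strategy -/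

/-- The strategy defined by the state machine. -/
def strategy (D : Design Mode n r N) (hN : Odd N) : Strategy Mode n r N where
  encode k y qs ps :=
    -- `memory` takes infinite sequences; by `memory_congr` the values beyond the known past are
    -- irrelevant.
    let Z := memory D (fun i => ps ⟨min i k, by omega⟩)
      (fun i => if h : i < k then qs ⟨i, h⟩ else ⟨0, pow_pos hN.pos r⟩) k
    quantize hN (radius D (ps (Fin.last k)) Z) (y - (D.mode (ps (Fin.last k))).C Z.est)
  decode k qs ps :=
    (memory D (fun i => ps ⟨min i k, by omega⟩) (fun i => qs ⟨min i k, by omega⟩) k).est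

theorem strategy_encode (D : Design Mode n r N) (hN : Odd N) (p : ℕ → Mode)
    (q : ℕ → Fin (N ^ r)) (k : ℕ) (y : Fin r → ℝ) :
    (strategy D hN).encode k y (fun i => q i) (fun i => p i) =
      quantize hN (radius D (p k) (memory D p q k))
        (y - (D.mode (p k)).C (memory D p q k).est) := by
  have h := memory_congr D (p := fun i => p (min i k)) (p' := p)
    (q := fun i => if _ : i < k then q i else ⟨0, pow_pos hN.pos r⟩) (q' := q) (k := k)
    (fun i hi => by rw [min_eq_left hi]) (fun i hi => dif_pos hi)
  simp only [strategy, Fin.val_last]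
  rw [h]

theorem strategy_decode (D : Design Mode n r N) (hN : Odd N) (p : ℕ → Mode)
    (q : ℕ → Fin (N ^ r)) (k : ℕ) :
    (strategy D hN).decode k (fun i => q i) (fun i => p i) = (memory D p q k).est := by
  have h := memory_congr D (p := fun i => p (min i k)) (p' := p)
    (q := fun i => q (min i k)) (q' := q) (k := k)
    (fun i hi => by rw [min_eq_left hi]) (fun i hi => by rw [min_eq_left hi.le])
  simp only [strategy]
  rw [h]

/-- The design is based on the exact sampled dynamics of the plant. -/
structure Design.Models (D : Design Mode n r N) (sys : SwitchedSystem Mode n m r)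
    (K : Mode → Matrix (Fin m) (Fin n) ℝ) (τ : ℝ) : Prop where
  C_apply : ∀ p v, (D.mode p).C v = (sys.C p).mulVec v
  Φ_eq : ∀ p, (D.mode p).Φ = flow (sys.A p + sys.B p * K p) τ
  Ψ_eq : ∀ p, (D.mode p).Ψ = flow (sys.A p) τ
  growth : ∀ (σ : ℝ → Mode) (p : Mode) (a : ℝ) (ξ : Fin n → ℝ) (x : ℝ → Fin n → ℝ),
      ContinuousOn x (Icc a (a + τ)) →
      (∀ t ∈ Ico a (a + τ),
        HasDerivWithinAt x (plantField sys K p (σ t) a ξ t (x t)) (Ici t) t) →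
      ∀ t ∈ Icc a (a + τ), ‖x t‖ ≤ D.c₀ * (‖x a‖ + ‖ξ‖)

theorem Design.Models.exists_sampled {D : Design Mode n r N} {sys : SwitchedSystem Mode n m r}
    {K : Mode → Matrix (Fin m) (Fin n) ℝ} {τ : ℝ} (hD : D.Models sys K τ) (hτ : 0 < τ)
    (hN : Odd N) {σ : ℝ → Mode} (hσ : IsSwitchingSignal σ) (hdw : HasDwellTime σ τ)
    {x : ℝ → Fin n → ℝ} (hx : IsTrajectory sys K τ (strategy D hN) σ x) :
    ∃ q, IsSampledTrajectory D hN (fun k : ℕ => σ (k * τ)) (fun k : ℕ => x (k * τ)) q ∧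
      ∀ k : ℕ, ∀ t ∈ Icc (k * τ) (k * τ + τ), ‖x t‖ ≤
        D.c₀ * (‖x (k * τ)‖ + ‖(memory D (fun k : ℕ => σ (k * τ)) q k).est‖) := by
  obtain ⟨q, hq, hcont, hder⟩ := hx
  set p : ℕ → Mode := fun k => σ (k * τ) with hp
  have hk0 : ∀ k : ℕ, 0 ≤ (k : ℝ) * τ := fun k => by positivity
  have hsucc : ∀ k : ℕ, ((k + 1 : ℕ) : ℝ) * τ = k * τ + τ := fun k => by push_cast; ring
  have hc : ∀ k : ℕ, ContinuousOn x (Icc (k * τ) (k * τ + τ)) := fun k =>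
    hcont.mono fun t ht => (hk0 k).trans ht.1
  have hd : ∀ k : ℕ, ∀ t ∈ Ico (k * τ) (k * τ + τ), HasDerivWithinAt x
      (plantField sys K (p k) (σ t) (k * τ) (memory D p q k).est t (x t)) (Ici t) t := by
    intro k t ht
    have := hder t ((hk0 k).trans ht.1)
    rw [control_eq sys K hτ _ σ q ht] at this
    rw [← strategy_decode D hN p q k]
    exact this
  have hgrowth : ∀ k : ℕ, ∀ t ∈ Icc (k * τ) (k * τ + τ), ‖x t‖ ≤
      D.c₀ * (‖x (k * τ)‖ + ‖(memory D p q k).est‖) := fun k =>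
    hD.growth σ (p k) _ _ x (hc k) (hd k)
  refine ⟨q, ⟨fun k => ?_, fun k => ?_, fun k hk => ?_⟩, hgrowth⟩
  · rw [hq k, map_sub, hD.C_apply]
    exact strategy_encode D hN p q k _
  · simp only [hsucc]
    exact hgrowth k _ ⟨by linarith, le_rfl⟩
  · obtain ⟨s, hs, hs1, hs2⟩ := hσ.exists_switch (hk0 k) (show k * τ < k * τ + τ by linarith)
      (hdw _ _ (hk0 k) (by linarith) (by linarith))
    rw [hD.Φ_eq, hD.Ψ_eq]
    simp only [hp, hsucc] at hk ⊢
    refine sub_flow_eq_of_no_switch sys K hτ.le (σ (k * τ)) _ _ (hc k) fun t ht => ?_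
    -- With at most one switch, equal modes at both ends leave no room for an excursion in between.
    have hσt : σ t = σ (k * τ) := by
      rcases lt_or_ge t s with hts | hts
      · exact hs1 t ⟨ht.1, hts⟩
      · rw [hs2 t ⟨hts, ht.2.le⟩, hk]
    have := hd k t ht
    rwa [hσt] at this

/-! ### Design of the constants -/

theorem sampledObs_mulVec (C : Matrix (Fin r) (Fin n) ℝ) (A : Matrix (Fin n) (Fin n) ℝ) (τ : ℝ)
    (k : ℕ) (z : Fin n → ℝ) (i : Fin k × Fin r) :
    (sampledObs C A τ k).mulVec z i = C.mulVec ((flow A τ ^ (i.1 : ℕ)) z) i.2 := by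
  rw [← flow_natCast_mul, flow_apply, Matrix.mulVec_mulVec]
  rfl

/-- The infimum of the empty set would be `0`. For `n > 0` a left inverse without columns would give
`0 = 1`; for `n = 0` the set contains `1`. -/
theorem obsIndex_pos {C : Matrix (Fin r) (Fin n) ℝ} {A : Matrix (Fin n) (Fin n) ℝ} {τ : ℝ}
    {W' : Matrix (Fin n) (Fin (obsIndex C A τ) × Fin r) ℝ}
    (hW' : W' * sampledObs C A τ (obsIndex C A τ) = 1) : 0 < obsIndex C A τ := by
  rw [Nat.pos_iff_ne_zero]
  intro h0
  have : IsEmpty (Fin (obsIndex C A τ) × Fin r) := by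
    rw [h0]
    infer_instance
  have h1 : (0 : Matrix (Fin n) (Fin n) ℝ) = 1 := by
    rw [← hW']
    ext i j
    simp [Matrix.mul_apply]
  rcases Nat.eq_zero_or_pos n with rfl | hn
  · have hmem : (1 : ℕ) ∈ {k : ℕ | 1 ≤ k ∧ (sampledObs C A τ k).rank = 0} :=
      ⟨le_rfl, Nat.le_zero.1 ((Matrix.rank_le_card_width _).trans_eq (Fintype.card_fin 0))⟩
    rcases Nat.sInf_eq_zero.1 h0 with h | h
    · exact absurd h.1 (by norm_num)
    · exact (h.subset hmem : (1 : ℕ) ∈ (∅ : Set ℕ))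
  · have := congrFun (congrFun h1 ⟨0, hn⟩) ⟨0, hn⟩
    simp at this

theorem exists_pow_gt {θ : ℝ} (hθ : θ < 1) (k : ℕ) : ∃ ϑ : ℝ, 0 < ϑ ∧ ϑ < 1 ∧ θ < ϑ ^ k := by
  have h1 : ∀ᶠ x : ℝ in 𝓝 1, θ < x ^ k :=
    ((continuous_pow k).tendsto' 1 1 (one_pow k)).eventually (lt_mem_nhds hθ)
  have h2 : ∀ᶠ x : ℝ in 𝓝 1, 0 < x := lt_mem_nhds one_pos
  obtain ⟨ϑ, ⟨h3, h4⟩, h5⟩ :=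
    (((h1.and h2).filter_mono nhdsWithin_le_nhds).and (self_mem_nhdsWithin (s := Iio 1))).exists
  exact ⟨ϑ, h4, h5, h3⟩

/-- The strict data-rate bound leaves room for a positive `μ` above all output norms and then for `ϑ
< 1` with `‖G‖ μ < N ϑ ^ η`. -/
theorem exists_modeData (hN : Odd N) {A : Matrix (Fin n) (Fin n) ℝ} {C : Matrix (Fin r) (Fin n) ℝ}
    {F : Matrix (Fin n) (Fin n) ℝ} (hF : IsHurwitz F) {τ : ℝ} (hτ : 0 < τ)
    {η : ℕ} (hηpos : 0 < η) {W' : Matrix (Fin n) (Fin η × Fin r) ℝ}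
    (hW' : W' * sampledObs C A τ η = 1)
    (hrate : infNorm (NormedSpace.exp (((η : ℝ) * τ) • A) * W') *
      (⨆ k : Fin η, infNorm (C * NormedSpace.exp (((k : ℝ) * τ) • A))) < N) :
    ∃ d : ModeData n r N, (∀ v, d.C v = C.mulVec v) ∧ d.Φ = flow F τ ∧ d.Ψ = flow A τ := by
  have hN' : (0 : ℝ) < N := by exact_mod_cast hN.pos
  set G : (Fin η × Fin r → ℝ) →L[ℝ] (Fin n → ℝ) :=
    LinearMap.toContinuousLinearMap (NormedSpace.exp (((η : ℝ) * τ) • A) * W').mulVecLin with hG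
  set M : ℝ := ⨆ k : Fin η, infNorm (C * NormedSpace.exp (((k : ℝ) * τ) • A)) with hM
  have hGM : ‖G‖ * M < N := hrate
  have hM0 : 0 ≤ M := Real.iSup_nonneg fun _ => norm_nonneg _
  have hout : ∀ i < η, ∀ z, ‖C.mulVec ((flow A τ ^ i) z)‖ ≤ M * ‖z‖ := by
    intro i hi z
    rw [← flow_natCast_mul, flow_apply, Matrix.mulVec_mulVec]
    refine (ContinuousLinearMap.le_opNorm (LinearMap.toContinuousLinearMap
      (C * NormedSpace.exp (((i : ℝ) * τ) • A)).mulVecLin) z).trans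
      (mul_le_mul_of_nonneg_right ?_ (norm_nonneg _))
    exact le_ciSup (f := fun k : Fin η => infNorm (C * NormedSpace.exp (((k : ℝ) * τ) • A)))
      (finite_range _).bddAbove ⟨i, hi⟩
  obtain ⟨μ, hMμ, hμ⟩ : ∃ μ, M < μ ∧ ‖G‖ * μ < N := by
    have h1 : ∀ᶠ x in 𝓝 M, ‖G‖ * x < N :=
      ((continuous_const.mul continuous_id).tendsto M).eventually (gt_mem_nhds hGM)
    obtain ⟨μ, h2, h3⟩ := ((h1.filter_mono nhdsWithin_le_nhds).and
      (self_mem_nhdsWithin (s := Ioi M))).exists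
    exact ⟨μ, h3, h2⟩
  have hμ0 : 0 < μ := hM0.trans_lt hMμ
  obtain ⟨ϑ, hϑ0, hϑ1, hϑ⟩ := exists_pow_gt ((div_lt_one hN').2 hμ) η
  rw [div_lt_iff₀ hN'] at hϑ
  obtain ⟨j, ρ, hj, hρ0, hρ1, hρ⟩ := hF.exists_norm_flow_pow_le hτ
  obtain ⟨g, L, hL, hg0, hg1, hg2, hg3, hg4⟩ := exists_contracted_gauge (flow F τ) hj hρ0 hρ
  set lam := (max ρ ϑ + 1) / 2 with hlam
  have hmax : max ρ ϑ < 1 := max_lt hρ1 hϑ1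
  have hlam1 : lam < 1 := by linarith
  have hρlam : ρ ≤ lam := by linarith [le_max_left ρ ϑ]
  have hϑlam : ϑ < lam := by linarith [le_max_right ρ ϑ]
  have hgap : 0 < lam - ϑ := sub_pos.2 hϑlam
  -- The slack `κ ϑ ^ η (lam - ϑ)` must absorb the gauge `L ‖G‖ μ` of the correction; the `+ 1`
  -- yields `κ ϑ ^ η ≥ 1`.
  set κ := (L * (‖G‖ * μ) + 1) / (ϑ ^ η * (lam - ϑ)) with hκ
  have hLG : 0 ≤ L * (‖G‖ * μ) := by positivity
  have hpow : 0 < ϑ ^ η := pow_pos hϑ0 η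
  have hκ1 : κ * ϑ ^ η * (lam - ϑ) = L * (‖G‖ * μ) + 1 := by
    rw [mul_assoc, hκ, div_mul_cancel₀]
    positivity
  have hκ0 : 0 < κ := by positivity
  refine ⟨{
    η := η
    C := LinearMap.toContinuousLinearMap C.mulVecLin
    Φ := flow F τ
    Ψ := flow A τ
    G := G
    g := g
    μ := μ
    ϑ := ϑ
    κ := κ
    lam := lam
    η_pos := hηpos
    G_outputs := fun z => ?_
    μ_pos := hμ0
    norm_output_le := fun i hi z => (hout i hi z).trans
      (mul_le_mul_of_nonneg_right hMμ.le (norm_nonneg _))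
    ϑ_pos := hϑ0
    norm_G_mul_le := by linarith
    g_zero := hg0
    norm_le_g := hg1
    g_add_le := hg3
    g_Φ_le := fun v => (hg4 v).trans
      (mul_le_mul_of_nonneg_right hρlam ((norm_nonneg v).trans (hg1 v)))
    ϑ_le_lam := hϑlam.le
    lam_lt_one := hlam1
    one_le_κ_mul := ?_
    g_G_le := fun v E hE hv => ?_ }, fun _ => rfl, rfl, rfl⟩
  · have h1 : (fun i : Fin η × Fin r => LinearMap.toContinuousLinearMap C.mulVecLin
        ((flow A τ ^ (i.1 : ℕ)) z) i.2) = (sampledObs C A τ η).mulVec z := by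
      funext i
      exact (sampledObs_mulVec C A τ η z i).symm
    rw [h1, ← flow_natCast_mul, flow_apply]
    change (NormedSpace.exp (((η : ℝ) * τ) • A) * W').mulVec _ = _
    rw [Matrix.mulVec_mulVec, Matrix.mul_assoc, hW', Matrix.mul_one]
  · have h1 : κ * ϑ ^ η * (lam - ϑ) ≤ κ * ϑ ^ η * 1 := by
      refine mul_le_mul_of_nonneg_left ?_ (by positivity)
      linarith
    linarith
  · have h1 : g (G v) ≤ L * (‖G‖ * μ) * E :=
      calc g (G v) ≤ L * ‖G v‖ := hg2 _
        _ ≤ L * (‖G‖ * (μ * E)) := mul_le_mul_of_nonneg_left (G.le_opNorm_of_le hv) hL.le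
        _ = L * (‖G‖ * μ) * E := by ring
    have h2 : ϑ ^ η = ϑ ^ (η - 1) * ϑ := by
      rw [← pow_succ, Nat.sub_add_cancel hηpos]
    have h3 : ϑ ^ η ≤ ϑ ^ (η - 1) := pow_le_pow_of_le_one hϑ0.le hϑ1.le (Nat.sub_le _ _)
    have h4 : L * (‖G‖ * μ) ≤ κ * ϑ ^ (η - 1) * (lam - ϑ) := by
      have := mul_le_mul_of_nonneg_right (mul_le_mul_of_nonneg_left h3 hκ0.le) hgap.le
      linarith
    have h5 := mul_le_mul_of_nonneg_right h4 hE
    rw [h2]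
    linarith

theorem exists_design [Finite Mode] (d : Mode → ModeData n r N) {c₀ : ℝ} (hc₀ : 1 ≤ c₀) :
    ∃ D : Design Mode n r N, D.mode = d ∧ D.c₀ = c₀ := by
  obtain ⟨b, hb0, hb⟩ := exists_forall_le_of_finite
    (fun p => ‖(d p).C‖ + ∑ i ∈ Finset.range (d p).η, ‖(d p).Ψ ^ i‖) 0
  obtain ⟨c, hc, hcG⟩ := exists_forall_le_of_finite (fun p => ‖(d p).G‖) (c₀ * (2 + b))
  obtain ⟨e, he1, he⟩ := exists_forall_le_of_finite
    (fun p => 1 / (d p).ϑ ^ (d p).η + N / (d p).μ) 1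
  -- The common contraction factor is `1 - 1 / l`; `l ≥ 2` keeps it positive.
  obtain ⟨l, hl2, hl⟩ := exists_forall_le_of_finite (fun p => 1 / (1 - (d p).lam)) 2
  obtain ⟨H, hH1, hH⟩ := exists_forall_le_of_finite (fun p => 2 * c * (d p).κ) 1
  obtain ⟨η, -, hη⟩ := exists_forall_le_of_finite (fun p => ((d p).η : ℝ)) 0
  have he0 : 0 < e := one_pos.trans_le he1
  have hl0 : 0 < l := two_pos.trans_le hl2
  have hlinv : 1 / l ≤ 1 / 2 := one_div_le_one_div_of_le two_pos hl2
  have hlinv0 : 0 < 1 / l := by positivity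
  have hsum : ∀ p, ∀ i < (d p).η, ‖(d p).Ψ ^ i‖ ≤ ∑ i ∈ Finset.range (d p).η, ‖(d p).Ψ ^ i‖ :=
    fun p i hi => Finset.single_le_sum (f := fun i => ‖(d p).Ψ ^ i‖) (fun i _ => norm_nonneg _)
      (Finset.mem_range.2 hi)
  refine ⟨{
    mode := d
    c₀ := c₀
    b := b
    c := c
    a := 1 / e
    lam := 1 - 1 / l
    H := H
    η := ⌈η⌉₊
    one_le_c₀ := hc₀
    b_nonneg := hb0
    norm_C_le := fun p => (le_add_of_nonneg_right
      (Finset.sum_nonneg fun i _ => norm_nonneg _)).trans (hb p)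
    norm_Ψ_pow_le := fun p i hi =>
      (hsum p i hi).trans ((le_add_of_nonneg_left (norm_nonneg _)).trans (hb p))
    norm_G_le := hcG
    le_c := hc
    a_pos := by positivity
    a_le_one := (div_le_one he0).2 he1
    a_le_ϑ := fun p => ?_
    a_le_μ := fun p => ?_
    lam_pos := by linarith
    lam_lt_one := by linarith
    le_lam := fun p => ?_
    one_le_H := hH1
    le_H := hH
    le_η := fun p => Nat.cast_le.1 ((hη p).trans (Nat.le_ceil η)) }, rfl, rfl⟩
  · have hpos : 0 < (d p).ϑ ^ (d p).η := pow_pos (d p).ϑ_pos _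
    have hμ : 0 ≤ N / (d p).μ := div_nonneg (Nat.cast_nonneg _) (d p).μ_pos.le
    rw [div_le_comm₀ he0 hpos]
    linarith [he p]
  · have hμ := (d p).μ_pos
    have hpos : 0 < 1 / (d p).ϑ ^ (d p).η := one_div_pos.2 (pow_pos (d p).ϑ_pos _)
    have h1 : N / (d p).μ ≤ e := by linarith [he p]
    rw [div_le_iff₀ hμ] at h1
    rw [div_mul_eq_mul_div, one_mul, div_le_iff₀ he0]
    linarith
  · have hgap : 0 < 1 - (d p).lam := sub_pos.2 (d p).lam_lt_one
    have := (one_div_le hl0 hgap).2 (hl p)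
    linarith

theorem Design.exists_admissibleRate (D : Design Mode n r N) {τ : ℝ} (hτ : 0 < τ) :
    ∃ τstar : ℝ, 0 < τstar ∧ ∀ τa, τstar < τa → D.AdmissibleRate (τ / τa) := by
  have hl := D.lam_pos
  have hlog : 0 ≤ Real.log (D.H / D.lam) :=
    Real.log_nonneg ((one_le_div hl).2 (D.lam_lt_one.le.trans D.one_le_H))
  have hneg : 0 < -Real.log D.lam := neg_pos.2 (Real.log_neg hl D.lam_lt_one)
  refine ⟨τ * (2 * Real.log (D.H / D.lam) / (-Real.log D.lam) + 2 * D.η + 1), by positivity,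
    fun τa hτa => ?_⟩
  have h1 : 0 ≤ τ * (2 * Real.log (D.H / D.lam) / (-Real.log D.lam)) := by positivity
  have h2 : 0 ≤ τ * (2 * D.η) := by positivity
  have hτa0 : 0 < τa := by linarith
  refine ⟨by positivity, ?_, ?_⟩
  · rw [div_mul_eq_mul_div, div_le_iff₀ hτa0]
    have h3 : τ * (2 * Real.log (D.H / D.lam) / (-Real.log D.lam)) ≤ τa := by linarith
    rw [mul_div_assoc', div_le_iff₀ hneg] at h3
    linarith
  · rw [div_mul_eq_mul_div, div_le_iff₀ hτa0]
    linarith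

theorem exists_euclNorm_bounds (n : ℕ) : ∃ M : ℝ, 0 < M ∧
    (∀ v : Fin n → ℝ, ‖v‖ ≤ M * euclNorm v) ∧ ∀ v : Fin n → ℝ, euclNorm v ≤ M * ‖v‖ := by
  let e := EuclideanSpace.equiv (Fin n) ℝ
  refine ⟨‖(e : EuclideanSpace ℝ (Fin n) →L[ℝ] (Fin n → ℝ))‖ +
    ‖(e.symm : (Fin n → ℝ) →L[ℝ] EuclideanSpace ℝ (Fin n))‖ + 1, by positivity, fun v => ?_,
    fun v => ?_⟩
  · refine ((e : EuclideanSpace ℝ (Fin n) →L[ℝ] (Fin n → ℝ)).le_opNorm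
      (WithLp.toLp 2 v)).trans (mul_le_mul_of_nonneg_right ?_ (norm_nonneg _))
    linarith [norm_nonneg (e.symm : (Fin n → ℝ) →L[ℝ] EuclideanSpace ℝ (Fin n))]
  · refine ((e.symm : (Fin n → ℝ) →L[ℝ] EuclideanSpace ℝ (Fin n)).le_opNorm v).trans
      (mul_le_mul_of_nonneg_right ?_ (norm_nonneg _))
    linarith [norm_nonneg (e : EuclideanSpace ℝ (Fin n) →L[ℝ] (Fin n → ℝ))]

theorem HasAverageDwellTime.numChanges_le {σ : ℝ → Mode} (hσ : IsSwitchingSignal σ) {τ : ℝ}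
    (hτ : 0 < τ) {τa : ℝ} {N₀ : ℕ} (h : HasAverageDwellTime σ τa N₀) (k : ℕ) :
    (numChanges (fun j : ℕ => σ (j * τ)) k : ℝ) ≤ N₀ + k * (τ / τa) := by
  rcases Nat.eq_zero_or_pos k with rfl | hk
  · simp [numChanges]
  have h1 : (numChanges (fun j : ℕ => σ (j * τ)) k : ℝ) ≤ numSwitches σ (k * τ) 0 := by
    exact_mod_cast hσ.numChanges_le hτ k
  refine h1.trans ((h 0 (k * τ) le_rfl (by positivity)).trans_eq ?_)
  rw [sub_zero, mul_div_assoc]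

end

end SwitchedControl

open SwitchedControl in
theorem theorem2p1 {Mode : Type*} [Finite Mode] {n m r : ℕ}
    (sys : SwitchedSystem Mode n m r) (τs : ℝ) (hτs : 0 < τs) (N : ℕ) (hN : Odd N)
    (K : Mode → Matrix (Fin m) (Fin n) ℝ)
    (hstab : ∀ p, IsStabilizable (sys.A p) (sys.B p))
    (hobs : ∀ p, IsObservable (sys.C p) (sys.A p))
    (hK : ∀ p, IsHurwitz (sys.A p + sys.B p * K p))
    (hpath : ∀ p, IsNonPathological (sys.A p) τs)
    (W' : ∀ p, Matrix (Fin n) (Fin (obsIndex (sys.C p) (sys.A p) τs) × Fin r) ℝ)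
    (hW' : ∀ p, W' p * sampledObs (sys.C p) (sys.A p) τs (obsIndex (sys.C p) (sys.A p) τs) = 1)
    (hrate : ∀ p, DataRateBound (sys.C p) (sys.A p) τs (W' p) N) :
    ∃ (τstar : ℝ) (S : Strategy Mode n r N), 0 < τstar ∧
      ∀ (τa : ℝ) (N₀ : ℕ), τstar < τa →
        -- the closed loop has a trajectory from every initial state, and all of them converge
        (∀ σ : ℝ → Mode, IsSwitchingSignal σ → HasDwellTime σ τs → HasAverageDwellTime σ τa N₀ →
          ∀ x₀ : Fin n → ℝ,
            (∃ x, IsTrajectory sys K τs S σ x ∧ x 0 = x₀) ∧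
            ∀ x, IsTrajectory sys K τs S σ x → x 0 = x₀ → Tendsto x atTop (𝓝 0)) ∧
        -- Lyapunov stability, uniformly in the switching signal
        (∀ ε : ℝ, 0 < ε → ∃ δ : ℝ, 0 < δ ∧
          ∀ σ : ℝ → Mode, IsSwitchingSignal σ → HasDwellTime σ τs → HasAverageDwellTime σ τa N₀ →
            ∀ x, IsTrajectory sys K τs S σ x → euclNorm (x 0) < δ →
              ∀ t, 0 ≤ t → euclNorm (x t) < ε) := by
  choose d hdC hdΦ hdΨ using fun p => exists_modeData hN (hK p) hτs (obsIndex_pos (hW' p)) (hW' p) (hrate p)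
  obtain ⟨c₀, hc₀, hgrowth⟩ := exists_growth_bound sys K τs
  obtain ⟨D, hDd, hDc⟩ := exists_design d hc₀
  have hD : D.Models sys K τs := by
    refine ⟨fun p v => ?_, fun p => ?_, fun p => ?_, ?_⟩
    · rw [hDd, hdC]
    · rw [hDd, hdΦ]
    · rw [hDd, hdΨ]
    · rw [hDc]
      exact hgrowth
  obtain ⟨τstar, hτstar, hrateD⟩ := D.exists_admissibleRate hτs
  refine ⟨τstar, strategy D hN, hτstar, fun τa N₀ hτa =>
    ⟨fun σ hσ hdw hadt x₀ => ⟨exists_isTrajectory sys K hτs hN.pos _ hσ hdw x₀,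
      fun x hx _ => ?_⟩, fun ε hε => ?_⟩⟩
  · obtain ⟨q, hq, hxt⟩ := hD.exists_sampled hτs hN hσ hdw hx
    have hlim := (hq.tendsto_zero (hrateD τa hτa) (hadt.numChanges_le hσ hτs)).const_mul D.c₀
    rw [mul_zero] at hlim
    have hfloor : Tendsto (fun t : ℝ => ⌊t / τs⌋₊) atTop atTop :=
      tendsto_nat_floor_atTop.comp (tendsto_id.atTop_div_const hτs)
    refine squeeze_zero_norm' ?_ (hlim.comp hfloor)
    filter_upwards [eventually_ge_atTop 0] with t ht
    exact hxt _ t (Ico_subset_Icc_self (mem_Ico_floor_div hτs ht))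
  · obtain ⟨M, hM, hM1, hM2⟩ := exists_euclNorm_bounds n
    have hc := D.c₀_pos
    -- `c₀` accounts for growth between samples, `M` for the change of norm, and `2` for the strict
    -- inequality.
    obtain ⟨δ, hδ, hstable⟩ := D.stable hN (hrateD τa hτa) N₀
      (show 0 < ε / (2 * (M * D.c₀)) by positivity)
    refine ⟨δ / M, by positivity, fun σ hσ hdw hadt x hx hx0 t ht => ?_⟩
    obtain ⟨q, hq, hxt⟩ := hD.exists_sampled hτs hN hσ hdw hx
    have h0 : ‖x ((0 : ℕ) * τs)‖ ≤ δ := by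
      rw [Nat.cast_zero, zero_mul]
      rw [lt_div_iff₀ hM] at hx0
      linarith [hM1 (x 0)]
    have h1 := hstable _ _ q hq (hadt.numChanges_le hσ hτs) h0 ⌊t / τs⌋₊
    have h2 := hxt _ t (Ico_subset_Icc_self (mem_Ico_floor_div hτs ht))
    have h3 : euclNorm (x t) ≤ M * D.c₀ * (ε / (2 * (M * D.c₀))) := by
      refine (hM2 _).trans ?_
      rw [mul_assoc]
      exact mul_le_mul_of_nonneg_left (h2.trans (mul_le_mul_of_nonneg_left h1 hc.le)) hM.le
    have h4 : M * D.c₀ * (ε / (2 * (M * D.c₀))) = ε / 2 := by field_simp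
    linarith
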